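/- **Theorem.** Let $\rho,\sigma$ be quantum states on the same finite-dimensional Hilbert space (positive semidefinite operators of trace one). Fix a logarithm base $b>1$, let $\log=\log_b$ with $\log 0=-\infty$, $\log\infty=\infty$, and let $\exp$ be its inverse function, with $\exp(-\infty)=0$, $\exp(\infty)=\infty$. Let $D(\rho\|\sigma)=\operatorname{Tr}\rho(\log\rho-\log\sigma)$ if $\operatorname{supp}\rho\subseteq\operatorname{supp}\sigma$ (operator logarithms being taken on the support), and $D(\rho\|\sigma)=\infty$ otherwise, be the Umegaki relative entropy, and let $$\widetilde D^{\varepsilon}_{\max}(\rho\|\sigma)=\log\inf\{\lambda\ge 0:\ \operatorname{Tr}(\rho-\lambda\sigma)_+\le\varepsilon\},\qquad \inf\emptyset=\infty,$$ where $X_+$ is the positive part of a Hermitian operator $X$. Then, with $(x)_+=\max\{x,0\}$ and $\|X\|_1=\operatorname{Tr}\sqrt{X^\dagger X}$, $$D(\rho\|\sigma)=\int_0^1\left(\widetilde D^{\varepsilon}_{\max}(\rho\|\sigma)+(\log e)\left(1-\exp\left[-\widetilde D^{\varepsilon}_{\max}(\sigma\|\rho)\right]\right)\right)_+\mathrm d\varepsilon$$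 $$\phantom{D(\rho\|\sigma)}=\int_0^{\frac12\|\rho-\sigma\|_1}\left(\widetilde D^{\varepsilon}_{\max}(\rho\|\sigma)+(\log e)\left(1-\exp\left[-\widetilde D^{\varepsilon}_{\max}(\sigma\|\rho)\right]\right)\right)\mathrm d\varepsilon .$$ The integrand is a measurable function of $\varepsilon\in[0,1]$ with values in $[-\infty,\infty]$, and the identities hold in $[0,\infty]$: the integrals are $+\infty$ exactly when $D(\rho\|\sigma)=\infty$. -/

import Mathlib

open MeasureTheory Set
open scoped ENNReal NNReal ComplexOrder

noncomputable section

namespace QuantumRelEntropy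

variable {n : Type*} [Fintype n] [DecidableEq n]

/-- A quantum state: a positive semidefinite operator of trace one on `ℂⁿ`. -/
def IsState (ρ : Matrix n n ℂ) : Prop :=
  ρ.PosSemidef ∧ ρ.trace = 1

/-- The support of a Hermitian operator (the orthogonal complement of its kernel), which is
its range. -/
def supp (A : Matrix n n ℂ) : Submodule ℂ (n → ℂ) :=
  LinearMap.range A.mulVecLin

/-- `Tr A₊`, the trace of the positive part of a Hermitian operator. -/
def trPosPart (A : Matrix n n ℂ) : ℝ :=
  (cfc (fun x : ℝ => max x 0) A).trace.re

/-- The Schatten 1-norm `‖X‖₁ = Tr √(X† X)`. -/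
def traceNorm (X : Matrix n n ℂ) : ℝ :=
  (cfc Real.sqrt (X.conjTranspose * X)).trace.re

/-- The logarithm to base `b > 1` on `[0, ∞]`, with `log 0 = -∞` and `log ∞ = ∞`. -/
def elog (b : ℝ) (x : ℝ≥0∞) : EReal :=
  ENNReal.log x * (((Real.log b)⁻¹ : ℝ) : EReal)

/-- The exponential to base `b > 1` on `[-∞, ∞]`, with `exp (-∞) = 0` and `exp ∞ = ∞`. -/
def eexp (b : ℝ) (y : EReal) : ℝ≥0∞ :=
  EReal.exp (y * ((Real.log b : ℝ) : EReal))

theorem eexp_elog {b : ℝ} (hb : 1 < b) (x : ℝ≥0∞) : eexp b (elog b x) = x := by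
  have h : (Real.log b)⁻¹ * Real.log b = 1 := inv_mul_cancel₀ (Real.log_pos hb).ne'
  rw [eexp, elog, mul_assoc, ← EReal.coe_mul, h, EReal.coe_one, mul_one, ENNReal.exp_log]

theorem elog_eexp {b : ℝ} (hb : 1 < b) (y : EReal) : elog b (eexp b y) = y := by
  have h : Real.log b * (Real.log b)⁻¹ = 1 := mul_inv_cancel₀ (Real.log_pos hb).ne'
  rw [eexp, elog, EReal.log_exp, mul_assoc, ← EReal.coe_mul, h, EReal.coe_one, mul_one]

open Classical in
/-- The Umegaki relative entropy `D(ρ‖σ) = Tr ρ (log ρ - log σ)` to base `b`, equal to `∞`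
if `supp ρ ⊄ supp σ`. Operator logarithms are taken on the support (`Real.logb b 0 = 0`). -/
def relEntropy (b : ℝ) (ρ σ : Matrix n n ℂ) : EReal :=
  if supp ρ ≤ supp σ then
    (((ρ * (cfc (Real.logb b) ρ - cfc (Real.logb b) σ)).trace.re : ℝ) : EReal)
  else ⊤

/-- The modified smooth max-relative entropy
`log inf {l ≥ 0 | Tr (ρ - l σ)₊ ≤ ε}` to base `b`, where `inf ∅ = ∞`. -/
def dmaxTilde (b ε : ℝ) (ρ σ : Matrix n n ℂ) : EReal :=
  elog b (⨅ (l : ℝ≥0) (_ : trPosPart (ρ - (l : ℝ) • σ) ≤ ε), (l : ℝ≥0∞))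

/-- The integrand `D̃^ε(ρ‖σ) + (log e) (1 - exp[-D̃^ε(σ‖ρ)])` to base `b`. -/
def integrand (b : ℝ) (ρ σ : Matrix n n ℂ) (ε : ℝ) : EReal :=
  dmaxTilde b ε ρ σ +
    ((Real.logb b (Real.exp 1) : ℝ) : EReal) *
      (1 - ((eexp b (-dmaxTilde b ε σ ρ) : ℝ≥0∞) : EReal))

/-- The Lebesgue integral over `s` of an extended-real-valued function: the integral of its
positive part minus the integral of its negative part. -/
def eintegral (s : Set ℝ) (F : ℝ → EReal) : EReal :=
  ((∫⁻ x in s, (F x).toENNReal : ℝ≥0∞) : EReal) -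
    ((∫⁻ x in s, (-F x).toENNReal : ℝ≥0∞) : EReal)

end QuantumRelEntropy

end

namespace QuantumRelEntropy

variable {n : Type*} [Fintype n] [DecidableEq n]

/-! ### Continuity of the functional calculus -/

section Continuity

open scoped Matrix.Norms.L2Operator

/-! Both sides reduce to integrals of `Tr(ρ - cσ)₊` and `Tr(σ - cρ)₊` over `c > 1`.

Entropy side. Replace `ρ`, `σ` by `ρ + u`, `σ + u`. The derivative in `u` of `Tr (ρ+u)(log(ρ+u) -
log(σ+u))` is `-Σᵢ (mᵢ - 1 - log mᵢ)`, where the `mᵢ` are the eigenvalues of `(σ+u)^(-1/2) (ρ+u)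
(σ+u)^(-1/2)`. Equal traces make the limit at infinity zero, so integrating over `u > 0` gives the
relative entropy in natural units, or `∞` if the support condition fails
(`relEntropy_eq_lintegral_shiftedDivergence`).

The scalar `m - 1 - log m` is an integral over `c > 1` of indicators of `c < m` and `c < 1/m`
(`lintegral_weights`). By Sylvester's law of inertia the number of `mᵢ > c` is the number of
eigenvalues of `ρ - cσ` above `(c-1)u` (`exists_relative_eigenvalues`). Integrating that count over
`u` gives `Tr(ρ - cσ)₊ / (c-1)`, and Tonelli yields `∫ c⁻¹ Tr(ρ - cσ)₊ dc + ∫ c⁻² Tr(σ - cρ)₊ dc`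
(`lintegral_trPosPart_eq_shiftedDivergence`).

Smoothing side. The smooth max-relative entropy is the logarithm of the generalised inverse of `c ↦
Tr(ρ - cσ)₊`. Layer cake with weights `c⁻¹` and `c⁻²` turns `log x` and `1 - 1/x` of these inverses
into the same two integrals (`lintegral_Ico_lintegral_indicator_genInv`). For equal traces both
functions agree at `c = 1`, with value half the trace norm; below this threshold both inverses
exceed one, above it neither does, which fixes the sign of the integrand. -/

theorem continuous_cfc_hermitian {X : Type*} [TopologicalSpace X] {A : X → Matrix n n ℂ}
    (hc : Continuous A) (hA : ∀ x, (A x).IsHermitian) {f : ℝ → ℝ} (hf : Continuous f) :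
    Continuous fun x => cfc f (A x) := by
  rw [continuous_iff_continuousAt]
  intro x
  -- Near `x` all spectra lie in one compact ball, on which `f` is uniformly approximable by
  -- polynomials.
  have hs : ∀ᶠ y in nhds x, spectrum ℝ (A y) ⊆ Metric.closedBall 0 (‖A x‖ + 1) := by
    have := (hc.norm.tendsto x).eventually (gt_mem_nhds (lt_add_one ‖A x‖))
    filter_upwards [this] with y hy
    cases isEmpty_or_nonempty n
    · intro z hz
      exact absurd hz (by rw [spectrum.of_subsingleton]; simp)
    exact (spectrum.subset_closedBall_norm (A y)).trans (Metric.closedBall_subset_closedBall hy.le)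
  exact ContinuousAt.cfc (isCompact_closedBall 0 (‖A x‖ + 1)) f hc.continuousAt hs
    (.of_forall hA) hf.continuousOn

end Continuity

/-! ### Spectral decomposition -/

theorem star_eigenvectorUnitary_mul {A : Matrix n n ℂ} (hA : A.IsHermitian) :
    star (hA.eigenvectorUnitary : Matrix n n ℂ) * hA.eigenvectorUnitary = 1 :=
  Unitary.coe_star_mul_self _

theorem eigenvectorUnitary_mul_star {A : Matrix n n ℂ} (hA : A.IsHermitian) :
    (hA.eigenvectorUnitary : Matrix n n ℂ) * star (hA.eigenvectorUnitary : Matrix n n ℂ) = 1 :=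
  Unitary.coe_mul_star_self _

theorem eq_conj_diagonal {A : Matrix n n ℂ} (hA : A.IsHermitian) :
    A = (hA.eigenvectorUnitary : Matrix n n ℂ) *
      Matrix.diagonal (fun i => (hA.eigenvalues i : ℂ)) *
        star (hA.eigenvectorUnitary : Matrix n n ℂ) := by
  conv_lhs => rw [hA.spectral_theorem, Unitary.conjStarAlgAut_apply]
  rfl

theorem cfc_eq_conj_diagonal {A : Matrix n n ℂ} (hA : A.IsHermitian) (f : ℝ → ℝ) :
    cfc f A = (hA.eigenvectorUnitary : Matrix n n ℂ) *
      Matrix.diagonal (fun i => (f (hA.eigenvalues i) : ℂ)) *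
        star (hA.eigenvectorUnitary : Matrix n n ℂ) := by
  rw [hA.cfc_eq, Matrix.IsHermitian.cfc, Unitary.conjStarAlgAut_apply]
  rfl

/-- The diagonal of `B` in the eigenbasis of `A`. -/
noncomputable def eigenDiag {A : Matrix n n ℂ} (hA : A.IsHermitian) (B : Matrix n n ℂ) (i : n) : ℝ :=
  ((star (hA.eigenvectorUnitary : Matrix n n ℂ) * B * hA.eigenvectorUnitary) i i).re

/-- By cyclicity only the diagonal of `B` in the eigenbasis of `A` meets the diagonal matrix, so no
commutation of `A` and `B` is needed. -/
theorem trace_mul_cfc {A : Matrix n n ℂ} (hA : A.IsHermitian) (B : Matrix n n ℂ) (f : ℝ → ℝ) :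
    (B * cfc f A).trace.re = ∑ i, eigenDiag hA B i * f (hA.eigenvalues i) := by
  have : (B * cfc f A).trace = ((star (hA.eigenvectorUnitary : Matrix n n ℂ) * B *
      hA.eigenvectorUnitary) * Matrix.diagonal (fun i => (f (hA.eigenvalues i) : ℂ))).trace := by
    rw [cfc_eq_conj_diagonal hA, ← mul_assoc, Matrix.trace_mul_comm]
    simp only [mul_assoc]
  rw [this, Matrix.trace, Complex.re_sum]
  refine Finset.sum_congr rfl fun i _ => ?_
  rw [Matrix.diag_apply, Matrix.mul_diagonal, Complex.re_mul_ofReal, eigenDiag]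

theorem trace_cfc {A : Matrix n n ℂ} (hA : A.IsHermitian) (f : ℝ → ℝ) :
    (cfc f A).trace.re = ∑ i, f (hA.eigenvalues i) := by
  have := trace_mul_cfc hA 1 f
  rw [one_mul] at this
  rw [this]
  refine Finset.sum_congr rfl fun i _ => ?_
  rw [eigenDiag, mul_one, star_eigenvectorUnitary_mul]
  simp

theorem eigenDiag_self {A : Matrix n n ℂ} (hA : A.IsHermitian) (i : n) :
    eigenDiag hA A i = hA.eigenvalues i := by
  have : star (hA.eigenvectorUnitary : Matrix n n ℂ) * A * hA.eigenvectorUnitary =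
      Matrix.diagonal (fun i => (hA.eigenvalues i : ℂ)) := by
    calc _ = star (hA.eigenvectorUnitary : Matrix n n ℂ) *
          ((hA.eigenvectorUnitary : Matrix n n ℂ) *
          Matrix.diagonal (fun i => (hA.eigenvalues i : ℂ)) *
          star (hA.eigenvectorUnitary : Matrix n n ℂ)) * hA.eigenvectorUnitary :=
          congrArg (fun X => star (hA.eigenvectorUnitary : Matrix n n ℂ) * X *
            (hA.eigenvectorUnitary : Matrix n n ℂ)) (eq_conj_diagonal hA)
      _ = _ := ?_
    rw [← mul_assoc, ← mul_assoc, star_eigenvectorUnitary_mul, one_mul, mul_assoc,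
      star_eigenvectorUnitary_mul, mul_one]
  rw [eigenDiag, this]
  simp

theorem sum_eigenDiag {A : Matrix n n ℂ} (hA : A.IsHermitian) (B : Matrix n n ℂ) :
    ∑ i, eigenDiag hA B i = B.trace.re := by
  have := trace_mul_cfc hA B (fun _ => 1)
  rw [cfc_const_one ℝ A hA.isSelfAdjoint, mul_one] at this
  simpa using this.symm

theorem trace_re_eq_sum_eigenvalues {A : Matrix n n ℂ} (hA : A.IsHermitian) :
    A.trace.re = ∑ i, hA.eigenvalues i := by
  rw [← sum_eigenDiag hA A]
  simp only [eigenDiag_self]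

theorem trPosPart_eq_sum {A : Matrix n n ℂ} (hA : A.IsHermitian) :
    trPosPart A = ∑ i, max (hA.eigenvalues i) 0 :=
  trace_cfc hA _

/-! ### Counting eigenvalues -/

/-- The number of eigenvalues of `A` larger than `t`. -/
noncomputable def eigCount {A : Matrix n n ℂ} (hA : A.IsHermitian) (t : ℝ) : ℕ :=
  Fintype.card {i // t < hA.eigenvalues i}

omit [DecidableEq n] in
/-- One half of Sylvester's law of inertia for diagonal forms. -/
theorem card_pos_le_card_pos (a b : n → ℝ) (P : Matrix n n ℂ)
    (h : ∀ x : n → ℂ, ∑ i, a i * ‖x i‖ ^ 2 ≤ ∑ i, b i * ‖P.mulVec x i‖ ^ 2) :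
    Fintype.card {i // 0 < a i} ≤ Fintype.card {i // 0 < b i} := by
  let E : ({i // 0 < a i} → ℂ) →ₗ[ℂ] (n → ℂ) :=
    { toFun := fun x i => if hi : 0 < a i then x ⟨i, hi⟩ else 0
      map_add' := fun x y => by ext i; by_cases hi : 0 < a i <;> simp [hi]
      map_smul' := fun c x => by ext i; by_cases hi : 0 < a i <;> simp [hi] }
  let R : (n → ℂ) →ₗ[ℂ] ({i // 0 < b i} → ℂ) := LinearMap.funLeft ℂ ℂ Subtype.val
  -- A kernel vector kills every positive term on the right, so the left sum, whose terms are
  -- nonnegative on the image of `E`, vanishes termwise.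
  have hinj : Function.Injective (R ∘ₗ P.mulVecLin ∘ₗ E) := by
    rw [← LinearMap.ker_eq_bot, LinearMap.ker_eq_bot']
    intro x hx
    have hb : ∑ i, b i * ‖P.mulVec (E x) i‖ ^ 2 ≤ 0 := by
      refine Finset.sum_nonpos fun i _ => ?_
      by_cases hi : 0 < b i
      · have : P.mulVec (E x) i = 0 := congrFun hx ⟨i, hi⟩
        simp [this]
      · exact mul_nonpos_of_nonpos_of_nonneg (not_lt.1 hi) (sq_nonneg _)
    have hnn : ∀ i ∈ Finset.univ, 0 ≤ a i * ‖E x i‖ ^ 2 := by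
      intro i _
      by_cases hi : 0 < a i
      · positivity
      · simp [E, hi]
    have h0 := (Finset.sum_eq_zero_iff_of_nonneg hnn).1
      (le_antisymm ((h (E x)).trans hb) (Finset.sum_nonneg hnn))
    ext ⟨i, hi⟩
    have := h0 i (Finset.mem_univ i)
    simpa [E, hi, hi.ne'] using this
  simpa using LinearMap.finrank_le_finrank_of_injective hinj

theorem eigCount_eq_card {A : Matrix n n ℂ} (hA : A.IsHermitian) (t : ℝ) :
    eigCount hA t = Fintype.card {i // 0 < 1 * hA.eigenvalues i - t} := by
  simp [eigCount, sub_pos]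

theorem quadForm_eq {A : Matrix n n ℂ} (hA : A.IsHermitian) (c t : ℝ) (x : n → ℂ) :
    (star x ⬝ᵥ ((c • A - t • (1 : Matrix n n ℂ)).mulVec x)).re =
      ∑ i, (c * hA.eigenvalues i - t) *
        ‖(star (hA.eigenvectorUnitary : Matrix n n ℂ)).mulVec x i‖ ^ 2 := by
  have hd : c • A - t • (1 : Matrix n n ℂ) = (hA.eigenvectorUnitary : Matrix n n ℂ) *
      Matrix.diagonal (fun i => ((c * hA.eigenvalues i - t : ℝ) : ℂ)) *
        star (hA.eigenvectorUnitary : Matrix n n ℂ) := by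
    have : Matrix.diagonal (fun i => ((c * hA.eigenvalues i - t : ℝ) : ℂ)) =
        c • Matrix.diagonal (fun i => (hA.eigenvalues i : ℂ)) - t • (1 : Matrix n n ℂ) := by
      ext i j
      by_cases hij : i = j <;> simp [hij]
    rw [this, mul_sub, sub_mul, mul_smul_comm, smul_mul_assoc, ← eq_conj_diagonal hA,
      mul_smul_comm, smul_mul_assoc, mul_one, eigenvectorUnitary_mul_star]
  rw [hd, ← Matrix.mulVec_mulVec, ← Matrix.mulVec_mulVec, Matrix.dotProduct_mulVec,
    show Matrix.vecMul (star x) (hA.eigenvectorUnitary : Matrix n n ℂ) =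
      star ((star (hA.eigenvectorUnitary : Matrix n n ℂ)).mulVec x) by
        rw [Matrix.star_mulVec, Matrix.star_eq_conjTranspose, Matrix.conjTranspose_conjTranspose],
    dotProduct, Complex.re_sum]
  refine Finset.sum_congr rfl fun i _ => ?_
  rw [Matrix.mulVec_diagonal, Pi.star_apply, mul_left_comm, Complex.re_ofReal_mul,
    RCLike.star_def, ← Complex.normSq_eq_conj_mul_self, Complex.ofReal_re, Complex.sq_norm]

/-- Monotonicity of the index of inertia under congruence and the Loewner order. -/
theorem card_pos_le_of_posSemidef {A B : Matrix n n ℂ} (hA : A.IsHermitian) (hB : B.IsHermitian)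
    (C : Matrix n n ℂ) (a s b t : ℝ)
    (h : (C.conjTranspose * (b • B - t • (1 : Matrix n n ℂ)) * C -
      (a • A - s • (1 : Matrix n n ℂ))).PosSemidef) :
    Fintype.card {i // 0 < a * hA.eigenvalues i - s} ≤
      Fintype.card {i // 0 < b * hB.eigenvalues i - t} := by
  refine card_pos_le_card_pos _ _ (star (hB.eigenvectorUnitary : Matrix n n ℂ) * C *
    (hA.eigenvectorUnitary : Matrix n n ℂ)) fun y => ?_
  set x := (hA.eigenvectorUnitary : Matrix n n ℂ).mulVec y with hx
  have hy : y = (star (hA.eigenvectorUnitary : Matrix n n ℂ)).mulVec x := by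
    rw [hx, Matrix.mulVec_mulVec, star_eigenvectorUnitary_mul, Matrix.one_mulVec]
  have hP : (star (hB.eigenvectorUnitary : Matrix n n ℂ) * C *
      (hA.eigenvectorUnitary : Matrix n n ℂ)).mulVec y =
      (star (hB.eigenvectorUnitary : Matrix n n ℂ)).mulVec (C.mulVec x) := by
    rw [hx]; simp only [Matrix.mulVec_mulVec, mul_assoc]
  rw [hP]
  conv_lhs => rw [hy]
  rw [← quadForm_eq hA, ← quadForm_eq hB]
  have h1 := (Complex.le_def.1 (h.dotProduct_mulVec_nonneg x)).1
  rw [Matrix.sub_mulVec, dotProduct_sub, Complex.sub_re, ← Matrix.mulVec_mulVec,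
    ← Matrix.mulVec_mulVec, Matrix.dotProduct_mulVec (star x) C.conjTranspose,
    ← Matrix.star_mulVec] at h1
  simpa using h1

theorem eigCount_le_of_le {A B : Matrix n n ℂ} (hA : A.IsHermitian) (hB : B.IsHermitian)
    (h : (B - A).PosSemidef) (t : ℝ) : eigCount hA t ≤ eigCount hB t := by
  rw [eigCount_eq_card, eigCount_eq_card]
  refine card_pos_le_of_posSemidef hA hB 1 1 t 1 t ?_
  simpa using h

theorem eigCount_sub_smul_one {A B : Matrix n n ℂ} (hA : A.IsHermitian) (hB : B.IsHermitian)
    (t : ℝ) (h : B = A - t • (1 : Matrix n n ℂ)) : eigCount hA t = eigCount hB 0 := by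
  rw [eigCount_eq_card, eigCount_eq_card]
  refine le_antisymm (card_pos_le_of_posSemidef hA hB 1 1 t 1 0 ?_)
    (card_pos_le_of_posSemidef hB hA 1 1 0 1 t ?_)
  · rw [h]; simpa using Matrix.PosSemidef.zero
  · rw [h]; simpa using Matrix.PosSemidef.zero

theorem coe_eigCount {A : Matrix n n ℂ} (hA : A.IsHermitian) (t : ℝ) :
    (eigCount hA t : ℝ≥0∞) = ∑ i, (Iio (hA.eigenvalues i)).indicator 1 t := by
  rw [eigCount, Fintype.card_subtype, Finset.card_filter]
  push_cast
  refine Finset.sum_congr rfl fun i _ => ?_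
  simp [indicator_apply]

/-- The count is discontinuous, but it is the pointwise limit of the continuous functions `Tr min(1,
k A₊)`. -/
theorem measurable_eigCount_zero {X : Type*} [TopologicalSpace X] [MeasurableSpace X] [BorelSpace X]
    {A : X → Matrix n n ℂ} (hc : Continuous A) (hA : ∀ x, (A x).IsHermitian) :
    Measurable fun x => (eigCount (hA x) 0 : ℝ≥0∞) := by
  have hm : Measurable fun x => (eigCount (hA x) 0 : ℝ) := by
    refine measurable_of_tendsto_metrizable
      (f := fun (k : ℕ) x => (cfc (fun y : ℝ => min 1 (k * max y 0)) (A x)).trace.re)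
      (fun k => ?_) ?_
    · exact (Complex.continuous_re.comp ((continuous_cfc_hermitian hc hA
        (by fun_prop)).matrix_trace)).measurable
    · rw [tendsto_pi_nhds]
      intro x
      have : (eigCount (hA x) 0 : ℝ) = ∑ i, if 0 < (hA x).eigenvalues i then (1 : ℝ) else 0 := by
        rw [eigCount, Fintype.card_subtype, Finset.card_filter]
        push_cast
        rfl
      rw [this]
      simp only [trace_cfc (hA x)]
      refine tendsto_finsetSum _ fun i _ => ?_
      by_cases hi : 0 < (hA x).eigenvalues i
      · rw [if_pos hi, max_eq_left hi.le]
        refine tendsto_const_nhds.congr' ?_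
        filter_upwards [(tendsto_natCast_atTop_atTop.atTop_mul_const hi).eventually_ge_atTop 1]
          with k hk
        exact (min_eq_left hk).symm
      · simp [hi, max_eq_right (not_lt.1 hi)]
  have : (fun x => (eigCount (hA x) 0 : ℝ≥0∞)) = fun x => ENNReal.ofReal (eigCount (hA x) 0 : ℝ) := by
    ext x; simp
  rw [this]
  exact hm.ennreal_ofReal

theorem lintegral_Iio_indicator (c : ℝ) (hc : 0 < c) (l : ℝ) :
    ENNReal.ofReal (max l 0) =
      ENNReal.ofReal c * ∫⁻ u in Ioi (0 : ℝ), (Iio l).indicator 1 (c * u) := by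
  have : (fun u : ℝ => (Iio l).indicator (1 : ℝ → ℝ≥0∞) (c * u)) =
      (Iio (l / c)).indicator 1 := by
    ext u
    simp only [indicator_apply, mem_Iio, lt_div_iff₀ hc, mul_comm c u, Pi.one_apply]
  rw [this, lintegral_indicator_one measurableSet_Iio, Measure.restrict_apply measurableSet_Iio,
    Iio_inter_Ioi, Real.volume_Ioo, sub_zero, ← ENNReal.ofReal_mul hc.le, mul_div_cancel₀ _ hc.ne',
    ENNReal.ofReal_max, ENNReal.ofReal_zero, max_eq_left zero_le]

/-- Layer cake for each eigenvalue. The free scale `c` will be `c - 1`, matching the threshold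
`(c-1)u`. -/
theorem ofReal_trPosPart {A : Matrix n n ℂ} (hA : A.IsHermitian) {c : ℝ} (hc : 0 < c) :
    ENNReal.ofReal (trPosPart A) =
      ENNReal.ofReal c * ∫⁻ u in Ioi (0 : ℝ), (eigCount hA (c * u) : ℝ≥0∞) := by
  have hm : ∀ l : ℝ, Measurable fun u : ℝ => (Iio l).indicator (1 : ℝ → ℝ≥0∞) (c * u) :=
    fun l => (measurable_const.indicator measurableSet_Iio).comp (measurable_const_mul c)
  simp only [coe_eigCount]
  rw [trPosPart_eq_sum hA, ENNReal.ofReal_sum_of_nonneg fun i _ => le_max_right _ _,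
    lintegral_finsetSum _ fun i _ => hm _, Finset.mul_sum]
  exact Finset.sum_congr rfl fun i _ => lintegral_Iio_indicator c hc _

/-! ### Trace of the positive part and trace norm -/

theorem trPosPart_nonneg {A : Matrix n n ℂ} (hA : A.IsHermitian) : 0 ≤ trPosPart A := by
  rw [trPosPart_eq_sum hA]
  exact Finset.sum_nonneg fun i _ => le_max_right _ _

/-- The positive part itself is not operator monotone; its trace is, because every eigenvalue count
is. -/
theorem trPosPart_mono {A B : Matrix n n ℂ} (hA : A.IsHermitian) (hB : B.IsHermitian)
    (h : (B - A).PosSemidef) : trPosPart A ≤ trPosPart B := by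
  rw [← ENNReal.ofReal_le_ofReal_iff (trPosPart_nonneg hB), ofReal_trPosPart hA one_pos,
    ofReal_trPosPart hB one_pos]
  gcongr with u
  exact eigCount_le_of_le hA hB h _

theorem trPosPart_eq_trace {A : Matrix n n ℂ} (hA : A.PosSemidef) : trPosPart A = A.trace.re := by
  rw [trPosPart_eq_sum hA.1, trace_re_eq_sum_eigenvalues hA.1]
  exact Finset.sum_congr rfl fun i _ => max_eq_left (hA.eigenvalues_nonneg i)

theorem continuous_trPosPart {X : Type*} [TopologicalSpace X] {A : X → Matrix n n ℂ}
    (hc : Continuous A) (hA : ∀ x, (A x).IsHermitian) : Continuous fun x => trPosPart (A x) :=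
  Complex.continuous_re.comp ((continuous_cfc_hermitian hc hA (by fun_prop)).matrix_trace)

omit [Fintype n] [DecidableEq n] in
theorem isHermitian_sub_smul {A B : Matrix n n ℂ} (hA : A.IsHermitian) (hB : B.IsHermitian)
    (c : ℝ) : (A - c • B).IsHermitian :=
  hA.sub (hB.smul (IsSelfAdjoint.all c))

theorem continuous_trPosPart_sub_smul {A B : Matrix n n ℂ} (hA : A.IsHermitian)
    (hB : B.IsHermitian) : Continuous fun c : ℝ => trPosPart (A - c • B) :=
  continuous_trPosPart (by fun_prop) fun c => isHermitian_sub_smul hA hB c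

theorem antitone_trPosPart_sub_smul {A B : Matrix n n ℂ} (hA : A.IsHermitian)
    (hB : B.PosSemidef) : Antitone fun c : ℝ => trPosPart (A - c • B) := by
  intro c d hcd
  refine trPosPart_mono (isHermitian_sub_smul hA hB.1 d) (isHermitian_sub_smul hA hB.1 c) ?_
  have : A - c • B - (A - d • B) = (d - c) • B := by rw [sub_smul]; abel
  rw [this]
  exact hB.smul (sub_nonneg.2 hcd)

theorem trPosPart_sub_trPosPart_neg {A : Matrix n n ℂ} (hA : A.IsHermitian) :
    trPosPart A - trPosPart (-A) = A.trace.re := by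
  have h : trPosPart (-A) = ∑ i, max (-hA.eigenvalues i) 0 := by
    rw [trPosPart, ← trace_cfc hA (fun x => max (-x) 0)]
    congr 2
    exact (cfc_comp_neg (fun x : ℝ => max x 0) A (by fun_prop) hA.isSelfAdjoint).symm
  rw [h, trPosPart_eq_sum hA, trace_re_eq_sum_eigenvalues hA, ← Finset.sum_sub_distrib]
  refine Finset.sum_congr rfl fun i _ => ?_
  rcases le_total (hA.eigenvalues i) 0 with h | h
  · rw [max_eq_right h, max_eq_left (by linarith)]; ring
  · rw [max_eq_left h, max_eq_right (by linarith)]; ring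

theorem traceNorm_eq {A : Matrix n n ℂ} (hA : A.IsHermitian) :
    traceNorm A = trPosPart A + trPosPart (-A) := by
  have h : traceNorm A = ∑ i, |hA.eigenvalues i| := by
    rw [traceNorm, ← trace_cfc hA (fun x => |x|)]
    congr 2
    have h2 : A.conjTranspose * A = cfc (fun x : ℝ => x ^ 2) A := by
      rw [cfc_pow_id A 2 hA.isSelfAdjoint, hA.eq, sq]
    rw [h2, ← cfc_comp' Real.sqrt (fun x : ℝ => x ^ 2) A (by fun_prop) (by fun_prop)
      hA.isSelfAdjoint]
    simp only [Real.sqrt_sq_eq_abs]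
  have h3 := trPosPart_sub_trPosPart_neg hA
  have h4 : traceNorm A = 2 * trPosPart A - A.trace.re := by
    rw [h, trPosPart_eq_sum hA, trace_re_eq_sum_eigenvalues hA, Finset.mul_sum,
      ← Finset.sum_sub_distrib]
    refine Finset.sum_congr rfl fun i _ => ?_
    rcases le_total (hA.eigenvalues i) 0 with h | h
    · rw [max_eq_right h, abs_of_nonpos h]; ring
    · rw [max_eq_left h, abs_of_nonneg h]; ring
  linarith

/-! ### Simultaneous diagonalisation of a pair of shifted states -/

theorem cfc_mul_cfc (A : Matrix n n ℂ) (f g : ℝ → ℝ) :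
    cfc f A * cfc g A = cfc (fun x => f x * g x) A :=
  (cfc_mul f g A (A.finite_real_spectrum.continuousOn f)
    (A.finite_real_spectrum.continuousOn g)).symm

theorem cfc_congr_eigenvalues {A : Matrix n n ℂ} (hA : A.IsHermitian) {f g : ℝ → ℝ}
    (h : ∀ i, f (hA.eigenvalues i) = g (hA.eigenvalues i)) : cfc f A = cfc g A := by
  rw [cfc_eq_conj_diagonal hA, cfc_eq_conj_diagonal hA]
  simp only [h]

theorem cfc_add_smul_one {A : Matrix n n ℂ} (hA : A.IsHermitian) (u : ℝ) :
    cfc (fun x : ℝ => x + u) A = A + u • (1 : Matrix n n ℂ) := by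
  rw [cfc_add_const (R := ℝ) u (fun x : ℝ => x) A (by fun_prop) hA.isSelfAdjoint, cfc_id' ℝ A hA.isSelfAdjoint,
    Algebra.algebraMap_eq_smul_one]

theorem det_cfc {A : Matrix n n ℂ} (hA : A.IsHermitian) (f : ℝ → ℝ) :
    (cfc f A).det = ((∏ i, f (hA.eigenvalues i) : ℝ) : ℂ) := by
  rw [cfc_eq_conj_diagonal hA, Matrix.det_mul_right_comm, eigenvectorUnitary_mul_star, one_mul,
    Matrix.det_diagonal]
  push_cast
  rfl

theorem eigenDiag_add_smul_one {A : Matrix n n ℂ} (hA : A.IsHermitian) (B : Matrix n n ℂ) (u : ℝ)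
    (i : n) : eigenDiag hA (B + u • (1 : Matrix n n ℂ)) i = eigenDiag hA B i + u := by
  rw [eigenDiag, mul_add, add_mul, mul_smul_comm, mul_one, smul_mul_assoc,
    star_eigenvectorUnitary_mul]
  simp [eigenDiag]

/-- With `C = (σ+u)^(-1/2)`, `D = C⁻¹` and `K = C(ρ+u)C`, congruence by `D` carries `K - c` to `ρ -
cσ - (c-1)u` and `1 - cK` to `σ - cρ - (c-1)u`. Inertia then gives both counts; the trace and
determinant of `K` give the two sums. -/
theorem exists_relative_eigenvalues {ρ σ : Matrix n n ℂ} (hρ : ρ.PosSemidef) (hσ : σ.PosSemidef)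
    {u : ℝ} (hu : 0 < u) :
    ∃ m : n → ℝ, (∀ i, 0 < m i) ∧
      (∀ c, (eigCount (isHermitian_sub_smul hρ.1 hσ.1 c) ((c - 1) * u) : ℝ≥0∞) =
        ∑ i, (Iio (m i)).indicator 1 c) ∧
      (∀ c, (eigCount (isHermitian_sub_smul hσ.1 hρ.1 c) ((c - 1) * u) : ℝ≥0∞) =
        ∑ i, (Iio (m i)⁻¹).indicator 1 c) ∧
      ∑ i, m i = ∑ i, (eigenDiag hσ.1 ρ i + u) / (hσ.1.eigenvalues i + u) ∧
      ∑ i, Real.log (m i) = ∑ i, Real.log (hρ.1.eigenvalues i + u) -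
        ∑ i, Real.log (hσ.1.eigenvalues i + u) := by
  have hq : ∀ i, 0 < hσ.1.eigenvalues i + u := fun i =>
    add_pos_of_nonneg_of_pos (hσ.eigenvalues_nonneg i) hu
  have hp : ∀ i, 0 < hρ.1.eigenvalues i + u := fun i =>
    add_pos_of_nonneg_of_pos (hρ.eigenvalues_nonneg i) hu
  set C : Matrix n n ℂ := cfc (fun x : ℝ => (√(x + u))⁻¹) σ with hC
  set D : Matrix n n ℂ := cfc (fun x : ℝ => √(x + u)) σ with hD
  have hCh : C.conjTranspose = C := (cfc_predicate _ σ : IsSelfAdjoint C)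
  have hDh : D.conjTranspose = D := (cfc_predicate _ σ : IsSelfAdjoint D)
  have hCD : C * D = 1 := by
    rw [hC, hD, cfc_mul_cfc σ, ← cfc_const_one ℝ σ hσ.1.isSelfAdjoint]
    exact cfc_congr_eigenvalues hσ.1 fun i => inv_mul_cancel₀ (Real.sqrt_pos.2 (hq i)).ne'
  have hDC : D * C = 1 := mul_eq_one_comm.1 hCD
  have hDD : D * D = σ + u • (1 : Matrix n n ℂ) := by
    rw [hD, cfc_mul_cfc σ, ← cfc_add_smul_one hσ.1]
    exact cfc_congr_eigenvalues hσ.1 fun i => Real.mul_self_sqrt (hq i).le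
  have hCC : C * C = cfc (fun x : ℝ => (x + u)⁻¹) σ := by
    rw [hC, cfc_mul_cfc σ]
    refine cfc_congr_eigenvalues hσ.1 fun i => ?_
    rw [← mul_inv, Real.mul_self_sqrt (hq i).le]
  set K : Matrix n n ℂ := C * (ρ + u • (1 : Matrix n n ℂ)) * C with hK
  have hdet : K.det = ((∏ i, (hρ.1.eigenvalues i + u) : ℝ) : ℂ) *
      ((∏ i, (hσ.1.eigenvalues i + u)⁻¹ : ℝ) : ℂ) := by
    rw [hK, Matrix.det_mul_right_comm, hCC, Matrix.det_mul, det_cfc hσ.1, ← cfc_add_smul_one hρ.1,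
      det_cfc hρ.1, mul_comm]
  have hKp : K.PosSemidef := by
    have := (hρ.add (Matrix.PosSemidef.one.smul hu.le)).conjTranspose_mul_mul_same C
    rwa [hCh] at this
  have hprod : ∏ i, hKp.1.eigenvalues i =
      (∏ i, (hρ.1.eigenvalues i + u)) * ∏ i, (hσ.1.eigenvalues i + u)⁻¹ := by
    have := hKp.1.det_eq_prod_eigenvalues
    rw [hdet] at this
    refine Complex.ofReal_injective ?_
    rw [Complex.ofReal_prod, Complex.ofReal_mul]
    exact this.symm
  have hprod_pos : 0 < ∏ i, hKp.1.eigenvalues i := by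
    rw [hprod]
    exact mul_pos (Finset.prod_pos fun i _ => hp i)
      (Finset.prod_pos fun i _ => inv_pos.2 (hq i))
  -- Nonnegative eigenvalues with nonzero product are positive.
  have hpos : ∀ i, 0 < hKp.1.eigenvalues i := fun i =>
    lt_of_le_of_ne (hKp.eigenvalues_nonneg i) fun h =>
      hprod_pos.ne' (Finset.prod_eq_zero (Finset.mem_univ i) h.symm)
  have hDKD : D * K * D = ρ + u • (1 : Matrix n n ℂ) := by
    rw [hK, show D * (C * (ρ + u • (1 : Matrix n n ℂ)) * C) * D =
      (D * C) * (ρ + u • (1 : Matrix n n ℂ)) * (C * D) by simp only [mul_assoc], hCD, hDC,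
      one_mul, mul_one]
  refine ⟨hKp.1.eigenvalues, hpos, fun c => ?_, fun c => ?_, ?_, ?_⟩
  · have h1 : eigCount (isHermitian_sub_smul hρ.1 hσ.1 c) ((c - 1) * u) = eigCount hKp.1 c := by
      have e1 : D * ((1 : ℝ) • K - c • (1 : Matrix n n ℂ)) * D =
          (1 : ℝ) • (ρ - c • σ) - ((c - 1) * u) • (1 : Matrix n n ℂ) := by
        rw [one_smul, mul_sub, sub_mul, hDKD, mul_smul_comm, mul_one, smul_mul_assoc, hDD]
        module
      have e2 : C * ((1 : ℝ) • (ρ - c • σ) - ((c - 1) * u) • (1 : Matrix n n ℂ)) * C =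
          (1 : ℝ) • K - c • (1 : Matrix n n ℂ) := by
        rw [← e1, show C * (D * ((1 : ℝ) • K - c • (1 : Matrix n n ℂ)) * D) * C =
          (C * D) * ((1 : ℝ) • K - c • (1 : Matrix n n ℂ)) * (D * C) by simp only [mul_assoc],
          hCD, hDC, one_mul, mul_one]
      rw [eigCount_eq_card, eigCount_eq_card]
      refine le_antisymm (card_pos_le_of_posSemidef _ _ D _ _ _ _ ?_)
        (card_pos_le_of_posSemidef _ _ C _ _ _ _ ?_)
      · rw [hDh, e1, sub_self]; exact .zero
      · rw [hCh, e2, sub_self]; exact .zero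
    rw [h1, coe_eigCount]
  -- The coefficients `-c` and `-1` encode `1 - cK`, positive at an eigenvalue `m` exactly when `c <
  -- 1/m`.
  · have h1 : eigCount (isHermitian_sub_smul hσ.1 hρ.1 c) ((c - 1) * u) =
        Fintype.card {i // 0 < -c * hKp.1.eigenvalues i - (-1)} := by
      have e1 : D * ((-c) • K - (-1 : ℝ) • (1 : Matrix n n ℂ)) * D =
          (1 : ℝ) • (σ - c • ρ) - ((c - 1) * u) • (1 : Matrix n n ℂ) := by
        rw [mul_sub, sub_mul, mul_smul_comm, smul_mul_assoc, hDKD, mul_smul_comm, mul_one,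
          smul_mul_assoc, hDD]
        module
      have e2 : C * ((1 : ℝ) • (σ - c • ρ) - ((c - 1) * u) • (1 : Matrix n n ℂ)) * C =
          (-c) • K - (-1 : ℝ) • (1 : Matrix n n ℂ) := by
        rw [← e1, show C * (D * ((-c) • K - (-1 : ℝ) • (1 : Matrix n n ℂ)) * D) * C =
          (C * D) * ((-c) • K - (-1 : ℝ) • (1 : Matrix n n ℂ)) * (D * C) by simp only [mul_assoc],
          hCD, hDC, one_mul, mul_one]
      rw [eigCount_eq_card]
      refine le_antisymm (card_pos_le_of_posSemidef _ _ D _ _ _ _ ?_)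
        (card_pos_le_of_posSemidef _ _ C _ _ _ _ ?_)
      · rw [hDh, e1, sub_self]; exact .zero
      · rw [hCh, e2, sub_self]; exact .zero
    rw [h1, Fintype.card_subtype, Finset.card_filter, Nat.cast_sum]
    refine Finset.sum_congr rfl fun i _ => ?_
    rw [Nat.cast_ite, Nat.cast_one, Nat.cast_zero]
    have : 0 < -c * hKp.1.eigenvalues i - (-1) ↔ c < (hKp.1.eigenvalues i)⁻¹ := by
      rw [← one_div, lt_div_iff₀ (hpos i)]
      constructor <;> intro h <;> linarith
    simp only [this, indicator_apply, mem_Iio, Pi.one_apply]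
  · rw [← trace_re_eq_sum_eigenvalues, hK, mul_assoc, Matrix.trace_mul_comm, mul_assoc, hCC,
      trace_mul_cfc hσ.1]
    simp only [eigenDiag_add_smul_one, div_eq_mul_inv]
  · rw [← Real.log_prod fun i _ => (hpos i).ne', hprod, Real.log_mul
      (Finset.prod_pos fun i _ => hp i).ne' (Finset.prod_pos fun i _ => inv_pos.2 (hq i)).ne',
      Real.log_prod fun i _ => (hp i).ne', Real.log_prod fun i _ => (inv_pos.2 (hq i)).ne',
      sub_eq_add_neg, ← Finset.sum_neg_distrib]
    simp only [Real.log_inv]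

/-! ### Scalar integrals -/

theorem lintegral_Ioo_ofReal_deriv {F f : ℝ → ℝ} {a b : ℝ} (hab : a ≤ b)
    (hd : ∀ x ∈ Icc a b, HasDerivAt F (f x) x) (hf : ContinuousOn f (Icc a b))
    (h0 : ∀ x ∈ Icc a b, 0 ≤ f x) :
    ∫⁻ x in Ioo a b, ENNReal.ofReal (f x) = ENNReal.ofReal (F b - F a) := by
  have hi : IntervalIntegrable f volume a b := (uIcc_of_le hab ▸ hf).intervalIntegrable
  rw [← intervalIntegral.integral_eq_sub_of_hasDerivAt (fun x hx => hd x (uIcc_of_le hab ▸ hx)) hi,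
    intervalIntegral.integral_of_le hab, integral_Ioc_eq_integral_Ioo,
    ofReal_integral_eq_lintegral_ofReal]
  · exact hf.integrableOn_Icc.mono_set Ioo_subset_Icc_self
  · exact (ae_restrict_mem measurableSet_Ioo).mono fun x hx => h0 x (Ioo_subset_Icc_self hx)

theorem lintegral_Ioi_mul_indicator_Iio (w : ℝ → ℝ≥0∞) (a b : ℝ) :
    ∫⁻ x in Ioi a, w x * (Iio b).indicator 1 x = ∫⁻ x in Ioo a b, w x := by
  have : (fun x => w x * (Iio b).indicator 1 x) = (Iio b).indicator w := by
    ext x; by_cases hx : x ∈ Iio b <;> simp [hx]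
  rw [this, lintegral_indicator measurableSet_Iio, Measure.restrict_restrict measurableSet_Iio,
    inter_comm, Ioi_inter_Iio]

theorem lintegral_Ioo_one_one_sub_inv {m : ℝ} (hm : 1 ≤ m) :
    ∫⁻ c in Ioo 1 m, ENNReal.ofReal (1 - c⁻¹) = ENNReal.ofReal (m - 1 - Real.log m) := by
  rw [lintegral_Ioo_ofReal_deriv (F := fun x => x - Real.log x) hm]
  · congr 1; simp; ring
  · intro x hx
    exact (hasDerivAt_id x).sub (Real.hasDerivAt_log (by linarith [hx.1]))
  · refine continuousOn_const.sub (continuousOn_inv₀.mono fun x hx => ?_)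
    have := hx.1
    simp; linarith
  · intro x hx
    exact sub_nonneg.2 (inv_le_one_of_one_le₀ hx.1)

theorem lintegral_Ioo_one_inv_sub_inv_sq {m : ℝ} (hm : 1 ≤ m) :
    ∫⁻ c in Ioo 1 m, ENNReal.ofReal (c⁻¹ - (c ^ 2)⁻¹) =
      ENNReal.ofReal (Real.log m + m⁻¹ - 1) := by
  rw [lintegral_Ioo_ofReal_deriv (F := fun x => Real.log x + x⁻¹) hm]
  · congr 1; simp
  · intro x hx
    have hx0 : x ≠ 0 := by linarith [hx.1]
    exact ((Real.hasDerivAt_log hx0).add (hasDerivAt_inv hx0)).congr_deriv (by ring)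
  · have h0 : ∀ x ∈ Icc 1 m, x ≠ 0 := fun x hx => by linarith [hx.1]
    exact (continuousOn_id.inv₀ h0).sub
      ((continuousOn_pow 2).inv₀ fun x hx => pow_ne_zero 2 (h0 x hx))
  · intro x hx
    have hx0 : 0 < x := by linarith [hx.1]
    refine sub_nonneg.2 (inv_anti₀ hx0 ?_)
    nlinarith [hx.1]

/-- One of the intervals `(1, m)`, `(1, 1/m)` is always empty. The second weight is the first one's
counterpart under `c ↦ 1/c`. Both carry a factor `c - 1`, which cancels the one from the integral
over `u`. -/
theorem lintegral_weights {m : ℝ} (hm : 0 < m) :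
    (∫⁻ c in Ioi (1 : ℝ), ENNReal.ofReal (1 - c⁻¹) * (Iio m).indicator 1 c) +
      (∫⁻ c in Ioi (1 : ℝ), ENNReal.ofReal (c⁻¹ - (c ^ 2)⁻¹) * (Iio m⁻¹).indicator 1 c) =
        ENNReal.ofReal (m - 1 - Real.log m) := by
  rw [lintegral_Ioi_mul_indicator_Iio fun c => ENNReal.ofReal (1 - c⁻¹),
    lintegral_Ioi_mul_indicator_Iio fun c => ENNReal.ofReal (c⁻¹ - (c ^ 2)⁻¹)]
  rcases le_total 1 m with h | h
  · rw [lintegral_Ioo_one_one_sub_inv h, Ioo_eq_empty (not_lt.2 (inv_le_one_of_one_le₀ h)),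
      Measure.restrict_empty, lintegral_zero_measure, add_zero]
  · rw [lintegral_Ioo_one_inv_sub_inv_sq ((one_le_inv₀ hm).2 h), Ioo_eq_empty (not_lt.2 h),
      Measure.restrict_empty, lintegral_zero_measure, zero_add, Real.log_inv, inv_inv]
    congr 1; ring

/-! ### Integral representation -/

/-- The trace of `M⁻¹(ρ + u) - 1 - log(ρ + u) + log M` for `M = σ + u`. -/
noncomputable def shiftedDivergence {ρ σ : Matrix n n ℂ} (hρ : ρ.PosSemidef) (hσ : σ.PosSemidef)
    (u : ℝ) : ℝ :=
  ∑ i, ((eigenDiag hσ.1 ρ i + u) / (hσ.1.eigenvalues i + u) - 1) -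
    (∑ i, Real.log (hρ.1.eigenvalues i + u) - ∑ i, Real.log (hσ.1.eigenvalues i + u))

theorem measurable_eigCount_sub_smul {ρ σ : Matrix n n ℂ} (hρ : ρ.PosSemidef) (hσ : σ.PosSemidef) :
    Measurable fun x : ℝ × ℝ =>
      (eigCount (isHermitian_sub_smul hρ.1 hσ.1 x.1) ((x.1 - 1) * x.2) : ℝ≥0∞) := by
  have hh : ∀ x : ℝ × ℝ,
      (ρ - x.1 • σ - ((x.1 - 1) * x.2) • (1 : Matrix n n ℂ)).IsHermitian := fun x =>
    isHermitian_sub_smul (isHermitian_sub_smul hρ.1 hσ.1 _) Matrix.isHermitian_one _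
  simp only [fun x : ℝ × ℝ => eigCount_sub_smul_one (isHermitian_sub_smul hρ.1 hσ.1 x.1) (hh x)
    ((x.1 - 1) * x.2) rfl]
  exact measurable_eigCount_zero (by fun_prop) hh

/-- Tonelli, with the factor `c - 1` absorbed into the weight. -/
theorem lintegral_ofReal_mul_of_eq_lintegral {F : ℝ → ℝ → ℝ≥0∞}
    (hF : Measurable fun x : ℝ × ℝ => F x.1 x.2) {w : ℝ → ℝ} (hw : Measurable w)
    (hw0 : ∀ c, 1 < c → 0 ≤ w c) {g : ℝ → ℝ≥0∞}
    (hg : ∀ c, 1 < c → g c = ENNReal.ofReal (c - 1) * ∫⁻ u in Ioi (0 : ℝ), F c u) :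
    ∫⁻ c in Ioi (1 : ℝ), ENNReal.ofReal (w c) * g c =
      ∫⁻ u in Ioi (0 : ℝ), ∫⁻ c in Ioi (1 : ℝ), ENNReal.ofReal (w c * (c - 1)) * F c u := by
  have hm : Measurable fun x : ℝ × ℝ => ENNReal.ofReal (w x.2 * (x.2 - 1)) * F x.2 x.1 :=
    (((hw.comp measurable_snd).mul (measurable_snd.sub_const 1)).ennreal_ofReal).mul
      (hF.comp measurable_swap)
  rw [lintegral_lintegral_swap hm.aemeasurable]
  refine setLIntegral_congr_fun measurableSet_Ioi fun c hc => ?_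
  have hmc : Measurable fun u : ℝ => F c u := hF.comp (measurable_prodMk_left (x := c))
  rw [hg c hc, ENNReal.ofReal_mul (hw0 c hc), ← mul_assoc, lintegral_const_mul _ hmc]

theorem lintegral_mul_trPosPart {ρ σ : Matrix n n ℂ} (hρ : ρ.PosSemidef) (hσ : σ.PosSemidef)
    {w : ℝ → ℝ} (hw : Measurable w) (hw0 : ∀ c, 1 < c → 0 ≤ w c) :
    ∫⁻ c in Ioi (1 : ℝ), ENNReal.ofReal (w c) * ENNReal.ofReal (trPosPart (ρ - c • σ)) =
      ∫⁻ u in Ioi (0 : ℝ), ∫⁻ c in Ioi (1 : ℝ), ENNReal.ofReal (w c * (c - 1)) *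
        (eigCount (isHermitian_sub_smul hρ.1 hσ.1 c) ((c - 1) * u) : ℝ≥0∞) := by
  refine lintegral_ofReal_mul_of_eq_lintegral
    (F := fun c u => (eigCount (isHermitian_sub_smul hρ.1 hσ.1 c) ((c - 1) * u) : ℝ≥0∞))
    (measurable_eigCount_sub_smul hρ hσ) hw hw0 fun c hc => ?_
  exact ofReal_trPosPart _ (sub_pos.2 hc)

theorem lintegral_trPosPart_eq_shiftedDivergence {ρ σ : Matrix n n ℂ} (hρ : ρ.PosSemidef)
    (hσ : σ.PosSemidef) :
    (∫⁻ c in Ioi (1 : ℝ), ENNReal.ofReal c⁻¹ * ENNReal.ofReal (trPosPart (ρ - c • σ))) +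
      (∫⁻ c in Ioi (1 : ℝ), ENNReal.ofReal (c ^ 2)⁻¹ * ENNReal.ofReal (trPosPart (σ - c • ρ))) =
      ∫⁻ u in Ioi (0 : ℝ), ENNReal.ofReal (shiftedDivergence hρ hσ u) := by
  have hm1 := measurable_eigCount_sub_smul hρ hσ
  rw [lintegral_mul_trPosPart hρ hσ (w := fun c => c⁻¹) (by fun_prop) (fun c hc => by positivity),
    lintegral_mul_trPosPart hσ hρ (w := fun c => (c ^ 2)⁻¹) (by fun_prop)
      (fun c hc => by positivity), ← lintegral_add_left]
  · refine setLIntegral_congr_fun measurableSet_Ioi fun u hu => ?_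
    obtain ⟨m, hm, h1, h2, h3, h4⟩ := exists_relative_eigenvalues hρ hσ hu
    simp only [h1, h2, Finset.mul_sum]
    have e1 : ∫⁻ c in Ioi (1 : ℝ), ∑ i, ENNReal.ofReal (c⁻¹ * (c - 1)) *
        (Iio (m i)).indicator 1 c = ∑ i, ∫⁻ c in Ioi (1 : ℝ), ENNReal.ofReal (1 - c⁻¹) *
        (Iio (m i)).indicator 1 c := by
      rw [← lintegral_finsetSum]
      · refine setLIntegral_congr_fun measurableSet_Ioi fun c hc => ?_
        have hc0 : c ≠ 0 := (zero_lt_one.trans hc).ne'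
        simp only [mul_sub, inv_mul_cancel₀ hc0, mul_one]
      · exact fun i _ => Measurable.mul (by fun_prop) (measurable_const.indicator measurableSet_Iio)
    have e2 : ∫⁻ c in Ioi (1 : ℝ), ∑ i, ENNReal.ofReal ((c ^ 2)⁻¹ * (c - 1)) *
        (Iio (m i)⁻¹).indicator 1 c = ∑ i, ∫⁻ c in Ioi (1 : ℝ),
        ENNReal.ofReal (c⁻¹ - (c ^ 2)⁻¹) * (Iio (m i)⁻¹).indicator 1 c := by
      rw [← lintegral_finsetSum]
      · refine setLIntegral_congr_fun measurableSet_Ioi fun c hc => ?_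
        have hc0 : c ≠ 0 := (zero_lt_one.trans hc).ne'
        have : (c ^ 2)⁻¹ * (c - 1) = c⁻¹ - (c ^ 2)⁻¹ := by field_simp
        simp only [this]
      · exact fun i _ => Measurable.mul (by fun_prop) (measurable_const.indicator measurableSet_Iio)
    rw [e1, e2, ← Finset.sum_add_distrib]
    simp only [lintegral_weights (hm _)]
    rw [← ENNReal.ofReal_sum_of_nonneg fun i _ => by linarith [Real.log_le_sub_one_of_pos (hm i)],
      shiftedDivergence]
    simp only [Finset.sum_sub_distrib]
    rw [h3, h4]
  · exact Measurable.lintegral_prod_right' (f := fun x : ℝ × ℝ => ENNReal.ofReal (x.2⁻¹ * (x.2 - 1)) *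
        (eigCount (isHermitian_sub_smul hρ.1 hσ.1 x.2) ((x.2 - 1) * x.1) : ℝ≥0∞))
      (Measurable.mul (by fun_prop) (hm1.comp measurable_swap))

theorem shiftedDivergence_nonneg {ρ σ : Matrix n n ℂ} (hρ : ρ.PosSemidef)
    (hσ : σ.PosSemidef) {u : ℝ} (hu : 0 < u) : 0 ≤ shiftedDivergence hρ hσ u := by
  obtain ⟨m, hm, -, -, h3, h4⟩ := exists_relative_eigenvalues hρ hσ hu
  rw [shiftedDivergence, Finset.sum_sub_distrib, ← h3, ← h4, ← Finset.sum_sub_distrib,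
    ← Finset.sum_sub_distrib]
  exact Finset.sum_nonneg fun i _ => by linarith [Real.log_le_sub_one_of_pos (hm i)]

/-! ### Evaluation of the integral of the shifted divergence -/

open Filter Topology in
theorem tendsto_add_mul_log_one_add_div (a c : ℝ) :
    Tendsto (fun u : ℝ => (a + u) * Real.log (1 + c / u)) atTop (𝓝 c) := by
  have h1 := Real.tendsto_mul_log_one_add_div_atTop c
  have h2 : Tendsto (fun u : ℝ => Real.log (1 + c / u)) atTop (𝓝 0) := by
    have : Tendsto (fun u : ℝ => 1 + c / u) atTop (𝓝 (1 + 0)) :=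
      tendsto_const_nhds.add (tendsto_id.const_div_atTop c)
    simpa using (this.log (by norm_num))
  have := (h2.const_mul a).add h1
  rw [mul_zero, zero_add] at this
  exact this.congr fun u => by ring

/-- An antiderivative of the negative of the shifted divergence. -/
noncomputable def shiftedEntropy {ρ σ : Matrix n n ℂ} (hρ : ρ.PosSemidef) (hσ : σ.PosSemidef)
    (u : ℝ) : ℝ :=
  ∑ i, (hρ.1.eigenvalues i + u) * Real.log (hρ.1.eigenvalues i + u) -
    ∑ i, (eigenDiag hσ.1 ρ i + u) * Real.log (hσ.1.eigenvalues i + u)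

section Shifted

variable {ρ σ : Matrix n n ℂ} (hρ : ρ.PosSemidef) (hσ : σ.PosSemidef)

theorem hasDerivAt_shiftedEntropy {u : ℝ} (hu : 0 < u) :
    HasDerivAt (shiftedEntropy hρ hσ) (-shiftedDivergence hρ hσ u) u := by
  have hq : ∀ i, hσ.1.eigenvalues i + u ≠ 0 := fun i =>
    (add_pos_of_nonneg_of_pos (hσ.eigenvalues_nonneg i) hu).ne'
  have hp : ∀ i, hρ.1.eigenvalues i + u ≠ 0 := fun i =>
    (add_pos_of_nonneg_of_pos (hρ.eigenvalues_nonneg i) hu).ne'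
  have hlin : ∀ a : ℝ, HasDerivAt (fun x => a + x) 1 u := fun a => (hasDerivAt_id u).const_add a
  have h1 := HasDerivAt.fun_sum fun (i : n) (_ : i ∈ Finset.univ) =>
    (hlin (hρ.1.eigenvalues i)).mul ((hlin (hρ.1.eigenvalues i)).log (hp i))
  have h2 := HasDerivAt.fun_sum fun (i : n) (_ : i ∈ Finset.univ) =>
    (hlin (eigenDiag hσ.1 ρ i)).mul ((hlin (hσ.1.eigenvalues i)).log (hq i))
  refine (h1.sub h2).congr_deriv ?_
  have e1 : ∀ i, 1 * Real.log (hρ.1.eigenvalues i + u) +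
      (hρ.1.eigenvalues i + u) * (1 / (hρ.1.eigenvalues i + u)) =
      Real.log (hρ.1.eigenvalues i + u) + 1 := fun i => by
    rw [mul_one_div_cancel (hp i), one_mul]
  have e2 : ∀ i, 1 * Real.log (hσ.1.eigenvalues i + u) +
      (eigenDiag hσ.1 ρ i + u) * (1 / (hσ.1.eigenvalues i + u)) =
      Real.log (hσ.1.eigenvalues i + u) +
        (eigenDiag hσ.1 ρ i + u) / (hσ.1.eigenvalues i + u) := fun i => by
    rw [one_mul, mul_one_div]
  simp only [e1, e2, shiftedDivergence, Finset.sum_add_distrib, Finset.sum_sub_distrib]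
  ring

open Filter Topology in
-- Split `log(a+u) = log u + log(1 + a/u)`. The `log u` terms cancel because the diagonal of `ρ`
-- sums to its trace; the rest tends to `Tr ρ - Tr σ`.
theorem tendsto_shiftedEntropy_atTop (htr : ρ.trace = σ.trace) :
    Tendsto (shiftedEntropy hρ hσ) atTop (𝓝 0) := by
  have hp := trace_re_eq_sum_eigenvalues hρ.1
  have hr := sum_eigenDiag hσ.1 ρ
  have hq := trace_re_eq_sum_eigenvalues hσ.1
  have h1 : Tendsto (fun u : ℝ =>
      ∑ i, (hρ.1.eigenvalues i + u) * Real.log (1 + hρ.1.eigenvalues i / u) -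
      ∑ i, (eigenDiag hσ.1 ρ i + u) * Real.log (1 + hσ.1.eigenvalues i / u)) atTop
      (𝓝 (∑ i, hρ.1.eigenvalues i - ∑ i, hσ.1.eigenvalues i)) :=
    (tendsto_finsetSum _ fun i _ => tendsto_add_mul_log_one_add_div _ _).sub
      (tendsto_finsetSum _ fun i _ => tendsto_add_mul_log_one_add_div _ _)
  rw [← hp, ← hq, htr, sub_self] at h1
  refine h1.congr' ?_
  filter_upwards [eventually_gt_atTop 0] with u hu
  have hlog : ∀ a, 0 ≤ a → Real.log (a + u) = Real.log u + Real.log (1 + a / u) := fun a ha => by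
    rw [← Real.log_mul hu.ne' (by positivity)]
    congr 1
    field_simp
    ring
  have e : ∀ a, 0 ≤ a → ∀ r, (r + u) * Real.log (a + u) =
      r * Real.log u + u * Real.log u + (r + u) * Real.log (1 + a / u) := fun a ha r => by
    rw [hlog a ha]; ring
  simp only [shiftedEntropy, e _ (hρ.eigenvalues_nonneg _), e _ (hσ.eigenvalues_nonneg _),
    Finset.sum_add_distrib, ← Finset.sum_mul]
  rw [hr, hp]
  ring

/-- A nonnegative derivative with a finite limit at infinity is integrable. The sign is recorded
because `ENNReal.ofReal` would hide a negative value. -/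
theorem lintegral_Ioi_shiftedDivergence (htr : ρ.trace = σ.trace) {a : ℝ} (ha : 0 < a) :
    0 ≤ shiftedEntropy hρ hσ a ∧ ∫⁻ u in Ioi a, ENNReal.ofReal (shiftedDivergence hρ hσ u) =
      ENNReal.ofReal (shiftedEntropy hρ hσ a) := by
  have hd : ∀ x ∈ Ici a, HasDerivAt (fun u => -shiftedEntropy hρ hσ u)
      (shiftedDivergence hρ hσ x) x := fun x hx =>
    (hasDerivAt_shiftedEntropy hρ hσ (ha.trans_le hx)).neg.congr_deriv (neg_neg _)
  have h0 : ∀ x ∈ Ioi a, 0 ≤ shiftedDivergence hρ hσ x := fun x hx =>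
    shiftedDivergence_nonneg hρ hσ (ha.trans hx)
  have ht := (tendsto_shiftedEntropy_atTop hρ hσ htr).neg
  have h1 := integral_Ioi_of_hasDerivAt_of_nonneg' hd h0 ht
  rw [neg_zero, zero_sub, neg_neg] at h1
  rw [← h1]
  exact ⟨setIntegral_nonneg measurableSet_Ioi h0,
    (ofReal_integral_eq_lintegral_ofReal (integrableOn_Ioi_deriv_of_nonneg' hd h0 ht)
      ((ae_restrict_mem measurableSet_Ioi).mono h0)).symm⟩

open Filter Topology in
-- Exhaustion of `(0, ∞)` by `(a, ∞)`; `I` may be `∞`, which covers the case of violated supports.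
theorem lintegral_shiftedDivergence_eq_of_tendsto (htr : ρ.trace = σ.trace) {I : ℝ≥0∞}
    (h : Tendsto (fun a => ENNReal.ofReal (shiftedEntropy hρ hσ a)) (𝓝[>] 0) (𝓝 I)) :
    ∫⁻ u in Ioi (0 : ℝ), ENNReal.ofReal (shiftedDivergence hρ hσ u) = I := by
  refine (aecover_Ioi_of_Ioi (μ := volume) (l := 𝓝[>] (0 : ℝ)) (a := id) (A := 0)
    nhdsWithin_le_nhds).lintegral_eq_of_tendsto I ?_ ?_
  · exact (by unfold shiftedDivergence; fun_prop : Measurable (shiftedDivergence hρ hσ)).ennreal_ofReal.aemeasurable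
  · refine h.congr' ?_
    filter_upwards [self_mem_nhdsWithin] with a ha
    rw [Measure.restrict_restrict measurableSet_Ioi, id,
      inter_eq_left.2 (Ioi_subset_Ioi (le_of_lt ha)),
      (lintegral_Ioi_shiftedDivergence hρ hσ htr ha).2]

include hρ in
theorem eigenDiag_nonneg (i : n) : 0 ≤ eigenDiag hσ.1 ρ i := by
  have h := hρ.conjTranspose_mul_mul_same (hσ.1.eigenvectorUnitary : Matrix n n ℂ)
  exact (Complex.le_def.1 (h.diag_nonneg (i := i))).1

theorem continuous_add_mul_log_add (a : ℝ) :
    Continuous fun u : ℝ => (a + u) * Real.log (a + u) :=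
  Real.continuous_mul_log.comp (continuous_const_add a)

open Filter Topology in
theorem tendsto_shiftedEntropy_zero
    (hs : ∀ i, hσ.1.eigenvalues i = 0 → eigenDiag hσ.1 ρ i = 0) :
    Tendsto (shiftedEntropy hρ hσ) (𝓝[>] 0) (𝓝
      (∑ i, hρ.1.eigenvalues i * Real.log (hρ.1.eigenvalues i) -
        ∑ i, eigenDiag hσ.1 ρ i * Real.log (hσ.1.eigenvalues i))) := by
  refine (tendsto_finsetSum _ fun i _ => ?_).sub (tendsto_finsetSum _ fun i _ => ?_)
  · simpa using ((continuous_add_mul_log_add (hρ.1.eigenvalues i)).tendsto 0).mono_left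
      nhdsWithin_le_nhds
  -- On the kernel of `σ` the term is `u log u`, which tends to `0` and agrees with `Real.log 0 =
  -- 0`.
  · by_cases hi : hσ.1.eigenvalues i = 0
    · rw [hs i hi, hi]
      simpa using ((continuous_add_mul_log_add 0).tendsto 0).mono_left nhdsWithin_le_nhds
    · have : ContinuousAt (fun u : ℝ => (eigenDiag hσ.1 ρ i + u) *
          Real.log (hσ.1.eigenvalues i + u)) 0 := by
        refine ContinuousAt.mul (by fun_prop) (ContinuousAt.log (by fun_prop) (by simpa using hi))
      simpa using this.tendsto.mono_left nhdsWithin_le_nhds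

open Filter Topology in
theorem tendsto_shiftedEntropy_zero_atTop {k : n} (hk : hσ.1.eigenvalues k = 0)
    (hr : eigenDiag hσ.1 ρ k ≠ 0) : Tendsto (shiftedEntropy hρ hσ) (𝓝[>] 0) atTop := by
  have hr0 : 0 < eigenDiag hσ.1 ρ k := lt_of_le_of_ne (eigenDiag_nonneg hρ hσ k) hr.symm
  have h1 : Tendsto (fun u : ℝ => ∑ i, (hρ.1.eigenvalues i + u) *
      Real.log (hρ.1.eigenvalues i + u)) (𝓝[>] 0)
      (𝓝 (∑ i, (hρ.1.eigenvalues i + 0) * Real.log (hρ.1.eigenvalues i + 0))) :=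
    tendsto_finsetSum _ fun i _ =>
      ((continuous_add_mul_log_add (hρ.1.eigenvalues i)).tendsto 0).mono_left nhdsWithin_le_nhds
  have h2 : Tendsto (fun u : ℝ => (eigenDiag hσ.1 ρ k + u) * -Real.log u) (𝓝[>] 0) atTop := by
    have h3 : Tendsto (fun u : ℝ => eigenDiag hσ.1 ρ k + u) (𝓝[>] 0)
        (𝓝 (eigenDiag hσ.1 ρ k + 0)) :=
      (continuous_const_add _).continuousAt.tendsto.mono_left nhdsWithin_le_nhds
    rw [add_zero] at h3
    exact h3.pos_mul_atTop hr0 (tendsto_neg_atBot_atTop.comp Real.tendsto_log_nhdsGT_zero)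
  -- The `k`-th term diverges; the other subtracted terms are bounded above, for `u < 1`, by their
  -- values at `u = 1`.
  have h3 := (h1.add_atTop h2).atTop_add (tendsto_const_nhds (x :=
    -∑ i ∈ Finset.univ.erase k, (eigenDiag hσ.1 ρ i + 1) * Real.log (hσ.1.eigenvalues i + 1)))
  refine tendsto_atTop_mono' _ ?_ h3
  filter_upwards [Ioo_mem_nhdsGT (zero_lt_one (α := ℝ))] with u hu
  rw [shiftedEntropy, ← Finset.add_sum_erase Finset.univ
    (fun i => (eigenDiag hσ.1 ρ i + u) * Real.log (hσ.1.eigenvalues i + u)) (Finset.mem_univ k)]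
  rw [hk, zero_add]
  have : ∑ i ∈ Finset.univ.erase k, (eigenDiag hσ.1 ρ i + u) * Real.log (hσ.1.eigenvalues i + u) ≤
      ∑ i ∈ Finset.univ.erase k, (eigenDiag hσ.1 ρ i + 1) * Real.log (hσ.1.eigenvalues i + 1) := by
    refine Finset.sum_le_sum fun i _ => ?_
    have hi := eigenDiag_nonneg hρ hσ i
    have hqi := hσ.eigenvalues_nonneg i
    have hu0 := hu.1
    have hu1 := hu.2
    have h4 : Real.log (hσ.1.eigenvalues i + u) ≤ Real.log (hσ.1.eigenvalues i + 1) :=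
      Real.log_le_log (by positivity) (by linarith)
    have h5 : 0 ≤ Real.log (hσ.1.eigenvalues i + 1) := Real.log_nonneg (by linarith)
    exact (mul_le_mul_of_nonneg_left h4 (by positivity)).trans
      (mul_le_mul_of_nonneg_right (by linarith) h5)
  linarith

include hρ in
-- If `σv = 0` and `ρv = σw`, then `⟨v, ρv⟩ = ⟨σv, w⟩ = 0`. Conversely, positivity turns `⟨v, ρv⟩ =
-- 0` into `ρv = 0`, so `ρ` is unchanged by the support projection of `σ`.
theorem supp_le_iff :
    supp ρ ≤ supp σ ↔ ∀ i, hσ.1.eigenvalues i = 0 → eigenDiag hσ.1 ρ i = 0 := by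
  set U := (hσ.1.eigenvectorUnitary : Matrix n n ℂ) with hU
  have hUU : U * star U = 1 := eigenvectorUnitary_mul_star hσ.1
  have hdiag : ∀ i, eigenDiag hσ.1 ρ i =
      (star (U.col i) ⬝ᵥ ρ.mulVec (U.col i)).re := fun i => by
    rw [eigenDiag, Matrix.mul_assoc, Matrix.mul_apply']
    rfl
  constructor
  · intro h i hi
    have hσv : σ.mulVec (U.col i) = 0 := by
      have := hσ.1.mulVec_eigenvectorBasis i
      rw [hi, zero_smul] at this
      exact this
    obtain ⟨w, hw⟩ := h (LinearMap.mem_range_self ρ.mulVecLin (U.col i))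
    rw [Matrix.mulVecLin_apply, Matrix.mulVecLin_apply] at hw
    rw [hdiag, ← hw, Matrix.dotProduct_mulVec, ← hσ.1.eq, ← Matrix.star_mulVec, hσv]
    simp
  · intro h
    have hcol : ∀ i, hσ.1.eigenvalues i = 0 → ρ.mulVec (U.col i) = 0 := fun i hi => by
      rw [← hρ.dotProduct_mulVec_zero_iff]
      have h1 := hρ.dotProduct_mulVec_nonneg (U.col i)
      refine Complex.ext ?_ (Complex.le_def.1 h1).2.symm
      rw [← hdiag, h i hi]; rfl
    -- Since `0⁻¹ = 0`, the function `x⁻¹ * x` gives the projection onto the support.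
    have hP : ρ * cfc (fun x : ℝ => x⁻¹ * x) σ = ρ := by
      have h2 : ρ * U * Matrix.diagonal (fun i =>
          (((hσ.1.eigenvalues i)⁻¹ * hσ.1.eigenvalues i : ℝ) : ℂ)) = ρ * U := by
        ext i j
        rw [Matrix.mul_diagonal]
        by_cases hj : hσ.1.eigenvalues j = 0
        · have : (ρ * U) i j = 0 := congrFun (hcol j hj) i
          rw [this, zero_mul]
        · rw [inv_mul_cancel₀ hj, Complex.ofReal_one, mul_one]
      rw [cfc_eq_conj_diagonal hσ.1, ← hU, ← mul_assoc, ← mul_assoc, h2, mul_assoc, hUU, mul_one]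
    have hQ : ρ = σ * (cfc (fun x : ℝ => x⁻¹) σ * ρ) := by
      have h3 := congrArg Matrix.conjTranspose hP
      rw [Matrix.conjTranspose_mul, hρ.1.eq, ← Matrix.star_eq_conjTranspose,
        (cfc_predicate _ σ : IsSelfAdjoint (cfc (fun x : ℝ => x⁻¹ * x) σ)).star_eq] at h3
      have h4 : σ * cfc (fun x : ℝ => x⁻¹) σ = cfc (fun x : ℝ => x⁻¹ * x) σ := by
        have h5 := cfc_mul_cfc σ (fun x : ℝ => x) (fun x : ℝ => x⁻¹)
        rw [cfc_id' ℝ σ hσ.1.isSelfAdjoint] at h5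
        rw [h5]
        simp only [mul_comm]
      rw [← mul_assoc, h4, h3]
    rintro _ ⟨x, rfl⟩
    refine ⟨(cfc (fun x : ℝ => x⁻¹) σ * ρ).mulVec x, ?_⟩
    rw [Matrix.mulVecLin_apply, Matrix.mulVecLin_apply, Matrix.mulVec_mulVec, ← hQ]

open Filter Topology in
theorem relEntropy_eq_lintegral_shiftedDivergence (htr : ρ.trace = σ.trace) {b : ℝ} (hb : 1 < b) :
    relEntropy b ρ σ = ((ENNReal.ofReal (Real.log b)⁻¹ *
      ∫⁻ u in Ioi (0 : ℝ), ENNReal.ofReal (shiftedDivergence hρ hσ u) : ℝ≥0∞) : EReal) := by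
  have hlb : 0 < (Real.log b)⁻¹ := inv_pos.2 (Real.log_pos hb)
  rw [relEntropy]
  split_ifs with h
  · have ht := tendsto_shiftedEntropy_zero hρ hσ ((supp_le_iff hρ hσ).1 h)
    have h0 := ge_of_tendsto ht (eventually_mem_nhdsWithin.mono fun a ha =>
      (lintegral_Ioi_shiftedDivergence hρ hσ htr ha).1)
    rw [lintegral_shiftedDivergence_eq_of_tendsto hρ hσ htr (ENNReal.tendsto_ofReal ht),
      ← ENNReal.ofReal_mul hlb.le, EReal.coe_ennreal_ofReal, max_eq_left (mul_nonneg hlb.le h0),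
      mul_sub, Matrix.trace_sub, Complex.sub_re, trace_mul_cfc hρ.1, trace_mul_cfc hσ.1]
    simp only [eigenDiag_self, Real.logb, div_eq_mul_inv, ← mul_assoc, ← Finset.sum_mul]
    congr 1
    ring
  · rw [supp_le_iff hρ hσ] at h
    push Not at h
    obtain ⟨k, hk, hr⟩ := h
    rw [lintegral_shiftedDivergence_eq_of_tendsto hρ hσ htr (I := ⊤)
      (ENNReal.tendsto_ofReal_atTop.comp (tendsto_shiftedEntropy_zero_atTop hρ hσ hk hr)),
      ENNReal.mul_top (ENNReal.ofReal_pos.2 hlb).ne', EReal.coe_ennreal_top]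

end Shifted

/-! ### Layer-cake formulas -/

/-- The generalised inverse `inf {l ≥ 0 | f l ≤ ε}` of a decreasing function. -/
noncomputable def genInv (f : ℝ → ℝ) (ε : ℝ) : ℝ≥0∞ :=
  ⨅ (l : ℝ≥0) (_ : f l ≤ ε), (l : ℝ≥0∞)

theorem genInv_antitone (f : ℝ → ℝ) : Antitone (genInv f) := fun _ _ h =>
  le_iInf₂ fun l hl => iInf₂_le l (hl.trans h)

/-- Continuity supplies the strictness: `ε < f c` persists at some `d > c`, so the infimum is at
least `d`. -/
theorem ofReal_lt_genInv_iff {f : ℝ → ℝ} (hf : Antitone f) (hc : Continuous f) {c : ℝ}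
    (h0 : 0 ≤ c) (ε : ℝ) : ENNReal.ofReal c < genInv f ε ↔ ε < f c := by
  constructor
  · intro h
    by_contra hle
    refine h.not_ge (iInf₂_le_of_le c.toNNReal ?_ le_rfl)
    rw [Real.coe_toNNReal _ h0]
    exact not_lt.1 hle
  · intro h
    obtain ⟨d, hd, hcd⟩ := ((hc.continuousAt.eventually_const_lt h).filter_mono
      (nhdsWithin_le_nhds (s := Ioi c)) |>.and self_mem_nhdsWithin).exists
    refine (ENNReal.ofReal_lt_ofReal_iff (h0.trans_lt hcd)).2 hcd |>.trans_le
      (le_iInf₂ fun l hl => ?_)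
    rw [ENNReal.ofReal_le_iff_le_toReal ENNReal.coe_ne_top, ENNReal.coe_toReal]
    by_contra hlt
    exact (hd.trans_le (hf (not_le.1 hlt).le)).not_ge hl

theorem genInv_le_one_iff {f : ℝ → ℝ} (hf : Antitone f) (hc : Continuous f) (ε : ℝ) :
    genInv f ε ≤ 1 ↔ f 1 ≤ ε := by
  rw [← not_lt, ← not_lt, ← ofReal_lt_genInv_iff hf hc zero_le_one, ENNReal.ofReal_one]

open Filter Topology in
-- The fundamental theorem of calculus on `(1, x)`, extended to `x = ∞` by exhaustion.
theorem lintegral_indicator_ofReal_lt {F w : ℝ → ℝ}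
    (hd : ∀ x, 1 ≤ x → HasDerivAt F (w x) x) (hw : ContinuousOn w (Ici 1))
    (hm : Measurable w) (h0 : ∀ x, 1 ≤ x → 0 ≤ w x) (hF : F 1 = 0) (G : ℝ≥0∞ → ℝ≥0∞)
    (hG : ∀ x, 1 ≤ x → G (ENNReal.ofReal x) = ENNReal.ofReal (F x))
    (htop : Tendsto (fun x => ENNReal.ofReal (F x)) atTop (𝓝 (G ⊤))) {x : ℝ≥0∞} (hx : 1 ≤ x) :
    ∫⁻ c in Ioi (1 : ℝ), ENNReal.ofReal (w c) * {c : ℝ | ENNReal.ofReal c < x}.indicator 1 c =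
      G x := by
  have key : ∀ m : ℝ, 1 ≤ m → ∫⁻ c in Ioo 1 m, ENNReal.ofReal (w c) = ENNReal.ofReal (F m) :=
    fun m hm => by
      rw [lintegral_Ioo_ofReal_deriv hm (fun x hx => hd x hx.1) (hw.mono fun x hx => hx.1)
        (fun x hx => h0 x hx.1), hF, sub_zero]
  induction x with
  | top =>
    have : {c : ℝ | ENNReal.ofReal c < ⊤} = univ := by ext; simp
    rw [this]
    simp only [indicator_univ, Pi.one_apply, mul_one]
    refine ((aecover_Iio (μ := volume) (tendsto_id (α := ℝ) (x := atTop))).restrict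
      (s := Ioi (1 : ℝ))).lintegral_eq_of_tendsto _ hm.ennreal_ofReal.aemeasurable ?_
    refine htop.congr' ?_
    filter_upwards [eventually_ge_atTop 1] with m hm
    rw [Measure.restrict_restrict measurableSet_Iio, inter_comm, Ioi_inter_Iio, id, key m hm]
  | coe y =>
    have hy : (1 : ℝ) ≤ y := by exact_mod_cast hx
    have h1 : ∫⁻ c in Ioi (1 : ℝ), ENNReal.ofReal (w c) *
        {c : ℝ | ENNReal.ofReal c < y}.indicator 1 c = ∫⁻ c in Ioi (1 : ℝ), ENNReal.ofReal (w c) *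
          (Iio (y : ℝ)).indicator 1 c := by
      refine setLIntegral_congr_fun measurableSet_Ioi fun c hc => ?_
      have hc0 : 0 ≤ c := zero_le_one.trans (le_of_lt hc)
      have : ENNReal.ofReal c < y ↔ c < y := by
        rw [ENNReal.ofReal_lt_iff_lt_toReal hc0 ENNReal.coe_ne_top, ENNReal.coe_toReal]
      simp only [indicator_apply, mem_ofPred_eq, this, mem_Iio]
    rw [h1, lintegral_Ioi_mul_indicator_Iio fun c => ENNReal.ofReal (w c), key _ hy, ← hG _ hy,
      ENNReal.ofReal_coe_nnreal]

open Filter Topology in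
theorem lintegral_inv_indicator_ofReal_lt {x : ℝ≥0∞} (hx : 1 ≤ x) :
    ∫⁻ c in Ioi (1 : ℝ), ENNReal.ofReal c⁻¹ * {c : ℝ | ENNReal.ofReal c < x}.indicator 1 c =
      (ENNReal.log x).toENNReal := by
  refine lintegral_indicator_ofReal_lt (F := Real.log) (w := fun c => c⁻¹)
    (G := fun x => (ENNReal.log x).toENNReal)
    (fun x hx => Real.hasDerivAt_log (by linarith)) ?_ measurable_inv
    (fun x hx => inv_nonneg.2 (by linarith)) Real.log_one (fun x hx => ?_) ?_ hx
  · exact continuousOn_inv₀.mono fun x (hx : 1 ≤ x) => (by linarith : x ≠ 0)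
  · rw [ENNReal.log_ofReal_of_pos (by linarith), EReal.toENNReal_of_ne_top (EReal.coe_ne_top _),
      EReal.toReal_coe]
  · rw [ENNReal.log_top, EReal.toENNReal_top]
    exact ENNReal.tendsto_ofReal_atTop.comp Real.tendsto_log_atTop

open Filter Topology in
theorem lintegral_inv_sq_indicator_ofReal_lt {x : ℝ≥0∞} (hx : 1 ≤ x) :
    ∫⁻ c in Ioi (1 : ℝ), ENNReal.ofReal (c ^ 2)⁻¹ *
      {c : ℝ | ENNReal.ofReal c < x}.indicator 1 c = 1 - x⁻¹ := by
  refine lintegral_indicator_ofReal_lt (F := fun c => 1 - c⁻¹) (w := fun c => (c ^ 2)⁻¹)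
    (G := fun x => 1 - x⁻¹)
    (fun x hx => ?_) ?_ (by fun_prop) (fun x hx => by positivity) (by simp) (fun x hx => ?_) ?_ hx
  · exact ((hasDerivAt_inv (by linarith : x ≠ 0)).const_sub 1).congr_deriv (neg_neg _)
  · exact (continuousOn_pow 2).inv₀ fun x (hx : 1 ≤ x) => pow_ne_zero 2 (by linarith : x ≠ 0)
  · rw [ENNReal.ofReal_sub _ (inv_nonneg.2 (by linarith)), ENNReal.ofReal_one,
      ENNReal.ofReal_inv_of_pos (by linarith)]
  · have : Tendsto (fun x : ℝ => 1 - x⁻¹) atTop (𝓝 (1 - 0)) :=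
      tendsto_const_nhds.sub tendsto_inv_atTop_zero
    simpa using ENNReal.tendsto_ofReal this

/-- After Tonelli, the slice at `c > 1` is `[0, f c)`, which lies inside `[0, f 1)` by monotonicity.
-/
theorem lintegral_Ico_lintegral_indicator_genInv {f : ℝ → ℝ} (hf : Antitone f)
    (hc : Continuous f) {w : ℝ → ℝ} (hw : Measurable w) :
    ∫⁻ ε in Ico 0 (f 1), ∫⁻ c in Ioi (1 : ℝ), ENNReal.ofReal (w c) *
      {c : ℝ | ENNReal.ofReal c < genInv f ε}.indicator 1 c =
    ∫⁻ c in Ioi (1 : ℝ), ENNReal.ofReal (w c) * ENNReal.ofReal (f c) := by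
  have h1 : ∀ ε, ∫⁻ c in Ioi (1 : ℝ), ENNReal.ofReal (w c) *
      {c : ℝ | ENNReal.ofReal c < genInv f ε}.indicator 1 c =
      ∫⁻ c in Ioi (1 : ℝ), ENNReal.ofReal (w c) * (Iio (f c)).indicator 1 ε := fun ε => by
    refine setLIntegral_congr_fun measurableSet_Ioi fun c hc1 => ?_
    simp only [indicator_apply, mem_ofPred_eq, mem_Iio,
      ofReal_lt_genInv_iff hf hc (zero_le_one.trans (le_of_lt hc1)), Pi.one_apply]
  simp only [h1]
  rw [lintegral_lintegral_swap]
  · refine setLIntegral_congr_fun measurableSet_Ioi fun c hc1 => ?_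
    rw [lintegral_const_mul _ (measurable_one.indicator measurableSet_Iio),
      lintegral_indicator_one measurableSet_Iio, Measure.restrict_apply measurableSet_Iio,
      inter_comm, Ico_inter_Iio, min_eq_right (hf (le_of_lt hc1)), Real.volume_Ico, sub_zero]
  · refine Measurable.aemeasurable (Measurable.mul (by fun_prop) ?_)
    have : (fun x : ℝ × ℝ => (Iio (f x.2)).indicator (1 : ℝ → ℝ≥0∞) x.1) =
        {x : ℝ × ℝ | x.1 < f x.2}.indicator 1 := by
      ext x; simp [indicator_apply]
    rw [this]
    exact measurable_one.indicator
      (measurableSet_lt measurable_fst (hc.measurable.comp measurable_snd))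

/-! ### The integrand -/

theorem coe_ennreal_one_sub {x : ℝ≥0∞} (hx : x ≤ 1) :
    ((1 - x : ℝ≥0∞) : EReal) = 1 - (x : EReal) := by
  lift x to ℝ≥0 using ne_top_of_le_ne_top ENNReal.one_ne_top hx
  have hx' : x ≤ 1 := by exact_mod_cast hx
  rw [← ENNReal.coe_one, ← ENNReal.coe_sub, EReal.coe_nnreal_eq_coe_real, NNReal.coe_sub hx',
    EReal.coe_nnreal_eq_coe_real]
  rfl

theorem integrand_eq {b : ℝ} (hb : 1 < b) (ρ σ : Matrix n n ℂ) (ε : ℝ) :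
    integrand b ρ σ ε =
      ENNReal.log (genInv (fun c => trPosPart (ρ - c • σ)) ε) * ((Real.log b)⁻¹ : ℝ) +
      ((Real.log b)⁻¹ : ℝ) *
        (1 - (((genInv (fun c => trPosPart (σ - c • ρ)) ε)⁻¹ : ℝ≥0∞) : EReal)) := by
  have h1 : ∀ ρ σ : Matrix n n ℂ,
      dmaxTilde b ε ρ σ = elog b (genInv (fun c => trPosPart (ρ - c • σ)) ε) := fun _ _ => rfl
  have h2 : ∀ x : ℝ≥0∞, -elog b x = elog b x⁻¹ := fun x => by
    rw [elog, elog, ENNReal.log_inv, EReal.neg_mul]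
  rw [integrand, h1, h1, h2, eexp_elog hb, Real.logb, Real.log_exp, one_div, elog]

/-- Monotonicity is the source of measurability in the final statement. -/
theorem integrand_antitone {b : ℝ} (hb : 1 < b) (ρ σ : Matrix n n ℂ) :
    Antitone (integrand b ρ σ) := by
  have hβ : (0 : EReal) ≤ (((Real.log b)⁻¹ : ℝ) : EReal) :=
    EReal.coe_nonneg.2 (inv_nonneg.2 (Real.log_pos hb).le)
  intro ε δ h
  rw [integrand_eq hb, integrand_eq hb]
  refine add_le_add (mul_le_mul_of_nonneg_right (ENNReal.log_le_log (genInv_antitone _ h)) hβ)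
    (mul_le_mul_of_nonneg_left (EReal.sub_le_sub le_rfl ?_) hβ)
  exact EReal.coe_ennreal_le_coe_ennreal_iff.2 (ENNReal.inv_le_inv.2 (genInv_antitone _ h))

/-! ### Sign and integral of the integrand for operators of equal trace -/

section States

variable {ρ σ : Matrix n n ℂ} (hρ : ρ.PosSemidef) (hσ : σ.PosSemidef)

include hρ hσ

/-- A traceless operator has positive and negative parts of equal trace, so both generalised
inverses cross one at the same `ε`. -/
theorem trPosPart_sub_comm (htr : ρ.trace = σ.trace) :
    trPosPart (σ - (1 : ℝ) • ρ) = trPosPart (ρ - (1 : ℝ) • σ) := by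
  have := trPosPart_sub_trPosPart_neg (isHermitian_sub_smul hρ.1 hσ.1 1)
  rw [one_smul] at *
  rw [neg_sub, Matrix.trace_sub, htr, sub_self, Complex.zero_re] at this
  rw [one_smul]
  linarith

theorem half_traceNorm_sub (htr : ρ.trace = σ.trace) :
    1 / 2 * traceNorm (ρ - σ) = trPosPart (ρ - (1 : ℝ) • σ) := by
  have h1 := trPosPart_sub_comm hρ hσ htr
  rw [traceNorm_eq (hρ.1.sub hσ.1), neg_sub]
  rw [one_smul, one_smul] at *
  rw [h1]
  ring

theorem integrand_nonpos (htr : ρ.trace = σ.trace) {b : ℝ} (hb : 1 < b) {ε : ℝ}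
    (hε : trPosPart (ρ - (1 : ℝ) • σ) ≤ ε) : integrand b ρ σ ε ≤ 0 := by
  have hβ : (0 : EReal) ≤ (((Real.log b)⁻¹ : ℝ) : EReal) :=
    EReal.coe_nonneg.2 (inv_nonneg.2 (Real.log_pos hb).le)
  have h1 := (genInv_le_one_iff (antitone_trPosPart_sub_smul hρ.1 hσ)
    (continuous_trPosPart_sub_smul hρ.1 hσ.1) ε).2 hε
  have h2 := (genInv_le_one_iff (antitone_trPosPart_sub_smul hσ.1 hρ)
    (continuous_trPosPart_sub_smul hσ.1 hρ.1) ε).2 (by rwa [trPosPart_sub_comm hρ hσ htr])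
  rw [integrand_eq hb]
  refine add_nonpos (mul_nonpos_of_nonpos_of_nonneg (ENNReal.log_le_zero_iff.2 h1) hβ)
    (mul_nonpos_of_nonneg_of_nonpos hβ ?_)
  have h3 : (1 : EReal) ≤ ((genInv (fun c => trPosPart (σ - c • ρ)) ε)⁻¹ : ℝ≥0∞) := by
    rw [← EReal.coe_ennreal_one]
    exact EReal.coe_ennreal_le_coe_ennreal_iff.2 (ENNReal.one_le_inv.2 h2)
  exact (EReal.sub_le_sub le_rfl h3).trans_eq (EReal.sub_self (EReal.coe_ne_top 1) (EReal.coe_ne_bot 1))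

/-- Below the threshold both inverses exceed one, so each summand is nonnegative and the
extended-real arithmetic can be done in `ℝ≥0∞`. -/
theorem integrand_eq_coe (htr : ρ.trace = σ.trace) {b : ℝ} (hb : 1 < b) {ε : ℝ}
    (hε : ε < trPosPart (ρ - (1 : ℝ) • σ)) :
    integrand b ρ σ ε = ((ENNReal.ofReal (Real.log b)⁻¹ *
      ((ENNReal.log (genInv (fun c => trPosPart (ρ - c • σ)) ε)).toENNReal +
        (1 - (genInv (fun c => trPosPart (σ - c • ρ)) ε)⁻¹)) : ℝ≥0∞) : EReal) := by
  have hβ : 0 ≤ (Real.log b)⁻¹ := inv_nonneg.2 (Real.log_pos hb).le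
  have h1 := not_le.1 fun h => hε.not_ge ((genInv_le_one_iff (antitone_trPosPart_sub_smul hρ.1 hσ)
    (continuous_trPosPart_sub_smul hρ.1 hσ.1) ε).1 h)
  have h2 := not_le.1 fun h => (trPosPart_sub_comm hρ hσ htr ▸ hε).not_ge
    ((genInv_le_one_iff (antitone_trPosPart_sub_smul hσ.1 hρ)
      (continuous_trPosPart_sub_smul hσ.1 hρ.1) ε).1 h)
  rw [integrand_eq hb, mul_add, EReal.coe_ennreal_add, EReal.coe_ennreal_mul,
    EReal.coe_ennreal_mul, EReal.coe_ennreal_ofReal, max_eq_left hβ,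
    EReal.coe_toENNReal (ENNReal.zero_le_log_iff.2 h1.le), mul_comm,
    coe_ennreal_one_sub (ENNReal.inv_le_one.2 h2.le)]

theorem lintegral_integrand (htr : ρ.trace = σ.trace) {b : ℝ} (hb : 1 < b) :
    ((∫⁻ ε in Ico 0 (trPosPart (ρ - (1 : ℝ) • σ)), (integrand b ρ σ ε).toENNReal : ℝ≥0∞) : EReal) =
      relEntropy b ρ σ := by
  have hfm : ∀ f : ℝ → ℝ, Measurable (genInv f) := fun f => (genInv_antitone f).measurable
  have hlog : Measurable fun ε =>
      (ENNReal.log (genInv (fun c => trPosPart (ρ - c • σ)) ε)).toENNReal :=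
    (ENNReal.measurable_log.comp (hfm _)).ereal_toENNReal
  have hinv : Measurable fun ε => 1 - (genInv (fun c => trPosPart (σ - c • ρ)) ε)⁻¹ :=
    measurable_const.sub (hfm _).inv
  have hf := antitone_trPosPart_sub_smul hρ.1 hσ
  have hfc := continuous_trPosPart_sub_smul hρ.1 hσ.1
  have hg := antitone_trPosPart_sub_smul hσ.1 hρ
  have hgc := continuous_trPosPart_sub_smul hσ.1 hρ.1
  have e1 : ∫⁻ ε in Ico 0 (trPosPart (ρ - (1 : ℝ) • σ)),
      (ENNReal.log (genInv (fun c => trPosPart (ρ - c • σ)) ε)).toENNReal =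
      ∫⁻ c in Ioi (1 : ℝ), ENNReal.ofReal c⁻¹ * ENNReal.ofReal (trPosPart (ρ - c • σ)) := by
    rw [← lintegral_Ico_lintegral_indicator_genInv hf hfc measurable_inv]
    refine setLIntegral_congr_fun measurableSet_Ico fun ε hε => ?_
    exact (lintegral_inv_indicator_ofReal_lt (not_lt.1 fun h =>
      hε.2.not_ge ((genInv_le_one_iff hf hfc ε).1 h.le))).symm
  have e2 : ∫⁻ ε in Ico 0 (trPosPart (ρ - (1 : ℝ) • σ)),
      (1 - (genInv (fun c => trPosPart (σ - c • ρ)) ε)⁻¹) =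
      ∫⁻ c in Ioi (1 : ℝ), ENNReal.ofReal (c ^ 2)⁻¹ * ENNReal.ofReal (trPosPart (σ - c • ρ)) := by
    rw [← trPosPart_sub_comm hρ hσ htr, ← lintegral_Ico_lintegral_indicator_genInv hg hgc
      (w := fun c => (c ^ 2)⁻¹) (by fun_prop)]
    refine setLIntegral_congr_fun measurableSet_Ico fun ε hε => ?_
    exact (lintegral_inv_sq_indicator_ofReal_lt (not_lt.1 fun h =>
      hε.2.not_ge ((genInv_le_one_iff hg hgc ε).1 h.le))).symm
  rw [relEntropy_eq_lintegral_shiftedDivergence hρ hσ htr hb,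
    ← lintegral_trPosPart_eq_shiftedDivergence hρ hσ, ← e1, ← e2, ← lintegral_add_left hlog,
    ← lintegral_const_mul' _ _ ENNReal.ofReal_ne_top]
  congr 1
  refine setLIntegral_congr_fun measurableSet_Ico fun ε hε => ?_
  rw [integrand_eq_coe hρ hσ htr hb hε.2, EReal.toENNReal_coe]

end States

end QuantumRelEntropy

/-! ### The two identities -/

open QuantumRelEntropy in
theorem mainTheorem7 {n : Type*} [Fintype n] [DecidableEq n]
    (ρ σ : Matrix n n ℂ) (hρ : QuantumRelEntropy.IsState ρ) (hσ : QuantumRelEntropy.IsState σ)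
    (b : ℝ) (hb : 1 < b) :
    AEMeasurable (QuantumRelEntropy.integrand b ρ σ) (volume.restrict (Icc (0 : ℝ) 1)) ∧
    QuantumRelEntropy.relEntropy b ρ σ =
      QuantumRelEntropy.eintegral (Icc (0 : ℝ) 1)
        (fun ε => max (QuantumRelEntropy.integrand b ρ σ ε) 0) ∧
    QuantumRelEntropy.relEntropy b ρ σ =
      QuantumRelEntropy.eintegral (Icc (0 : ℝ) (1 / 2 * QuantumRelEntropy.traceNorm (ρ - σ)))
        (QuantumRelEntropy.integrand b ρ σ) := by
  obtain ⟨hρ, hρ1⟩ := hρ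
  obtain ⟨hσ, hσ1⟩ := hσ
  have htr : ρ.trace = σ.trace := hρ1.trans hσ1.symm
  have hmain := lintegral_integrand hρ hσ htr hb
  refine ⟨(integrand_antitone hb ρ σ).measurable.aemeasurable, ?_, ?_⟩
  -- The value at `c = 1` is at most that at `c = 0`, which is `Tr ρ = 1`.
  · have hT : trPosPart (ρ - (1 : ℝ) • σ) ≤ 1 := by
      refine (antitone_trPosPart_sub_smul hρ.1 hσ zero_le_one).trans_eq ?_
      simp only [zero_smul, sub_zero]
      rw [trPosPart_eq_trace hρ, hρ1, Complex.one_re]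
    have hneg : ∀ ε, (-max (integrand b ρ σ ε) 0).toENNReal = 0 := fun ε =>
      EReal.toENNReal_of_nonpos (EReal.neg_le.2 (by simp))
    have hpos : ∀ ε ∈ Icc (0 : ℝ) 1, (max (integrand b ρ σ ε) 0).toENNReal =
        (Ico 0 (trPosPart (ρ - (1 : ℝ) • σ))).indicator
          (fun ε => (integrand b ρ σ ε).toENNReal) ε := fun ε hε => by
      by_cases h : ε < trPosPart (ρ - (1 : ℝ) • σ)
      · rw [indicator_of_mem (show ε ∈ Ico _ _ from ⟨hε.1, h⟩), max_eq_left]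
        rw [integrand_eq_coe hρ hσ htr hb h]
        exact EReal.coe_ennreal_nonneg _
      · rw [indicator_of_notMem (fun hmem => h hmem.2),
          max_eq_right (integrand_nonpos hρ hσ htr hb (not_lt.1 h)), EReal.toENNReal_zero]
    rw [eintegral]
    simp only [hneg, lintegral_zero, EReal.coe_ennreal_zero, sub_zero]
    rw [setLIntegral_congr_fun measurableSet_Icc hpos, lintegral_indicator measurableSet_Ico,
      Measure.restrict_restrict measurableSet_Ico, inter_eq_left.2
        (Ico_subset_Icc_self.trans (Icc_subset_Icc_right hT)), hmain]
  · have hneg : ∫⁻ ε in Ico 0 (trPosPart (ρ - (1 : ℝ) • σ)), (-integrand b ρ σ ε).toENNReal = 0 := by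
      rw [← lintegral_zero (μ := volume.restrict (Ico 0 (trPosPart (ρ - (1 : ℝ) • σ))))]
      refine setLIntegral_congr_fun measurableSet_Ico fun ε hε => ?_
      rw [integrand_eq_coe hρ hσ htr hb hε.2]
      exact EReal.toENNReal_of_nonpos (EReal.neg_le_zero.2 (EReal.coe_ennreal_nonneg _))
    -- The right endpoint, where the integrand may be negative, is a null set.
    rw [eintegral, half_traceNorm_sub hρ hσ htr, ← restrict_Ico_eq_restrict_Icc, hneg, hmain,
      EReal.coe_ennreal_zero, sub_zero]
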